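/- Let $\gamma\colon\mathbb R\to\mathbb R^2$ be a regular $C^3$ map (so $\gamma'\neq 0$ everywhere) that is periodic with period $L>0$ and injective on $[0,L)$, and let $\Gamma=\gamma(\mathbb R)$ be the simple closed curve it parametrizes, oriented by $\gamma$. Let $\kappa=\det(\gamma',\gamma'')/|\gamma'|^3$ be its signed curvature and $\dot\kappa$ the derivative of $\kappa$ with respect to arc length. Let $\sigma_\gamma=(\kappa,\dot\kappa)\colon\mathbb R\to\mathbb R^2$, and let $\sigma_\Gamma\colon\Gamma\to\mathbb R^2$ be the signature map, $\sigma_\Gamma\circ\gamma=\sigma_\gamma$; the signature of $\Gamma$ is $S_\Gamma=\sigma_\Gamma(\Gamma)$. Assume that $\Gamma$ is non-degenerate, i.e. the points of $\Gamma$ at which $\dot\kappa=0$ are isolated. A point $q\in S_\Gamma$ is called simple if some open set of the plane containing $q$ meets $S_\Gamma$ in a set homeomorphic to $\mathbb R$ or to a half-open interval, and a point of self-intersection otherwise. Assume that the set $Q$ of self-intersection points of $S_\Gamma$ is finite and non-empty. The edges of the signature quiver are the connected components of $S_\Gamma\setminus Q$. As $t$ runs through one period, $\sigma_\gamma$ traces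 a closed path of edges: every interval $(a,b)$ between two consecutive times of $\sigma_\gamma^{-1}(Q)$ with $a\in[0,L)$ contributes the edge $\sigma_\gamma((a,b))$. The multiplicity $\mu(E)$ of an edge $E$ is the number of times it occurs in this path. For $p\in\Gamma$ the local signature index of $\Gamma$ at $p$ is the cardinality of $\sigma_\Gamma^{-1}(\sigma_\Gamma(p))$, and the global signature index of $\Gamma$ is the minimum of the local ones over $p\in\Gamma$. A local symmetry of $\Gamma$ based at $p$ is a $g\in SE(2)$ for which there is an open $U\subset\mathbb R^2$ containing $p$ with $g\cdot(\Gamma\cap U)=\Gamma\cap(g\cdot U)$ as oriented sets (i.e. $g$ also carries the unit tangent vectors of $\Gamma$ at the points of $\Gamma\cap U$ to those of $\Gamma$ at the image points); the local symmetry index at $p$ is the number of these. Two pieces of $\Gamma$ are congruent if some $g\in SE(2)$ maps one onto the other preserving the orientations. Then there are finitely many edges $S_1,\dots,S_N$, each of them is an open curve segment (the image under $\sigma_\gamma$ of an open interval, homeomorphic to an open interval in the subspace topology), and for every $i$, with $\mu_i=\mu(S_i)$: 1. $\mu_i$ is finite, and $\sigma_\Gamma^{-1}(S_i)$ has exactly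 $\mu_i$ connected components; each of them is an open curve segment of $\Gamma$ (the image under $\gamma$ of an open interval, homeomorphic to an open interval), and any two of them are congruent. 2. At every point $p$ of these components, the local signature index and the local symmetry index of $\Gamma$ are both equal to $\mu_i$. Moreover, the global signature index of $\Gamma$ equals $\min_{1\le i\le N}\mu_i$. -/

import Mathlib

open Set

namespace PlaneCurve

/-- The Euclidean plane. -/
abbrev Plane : Type := EuclideanSpace ℝ (Fin 2)

/-- The determinant of the matrix with columns `u` and `v`. -/
def det2 (u v : Plane) : ℝ := u 0 * v 1 - u 1 * v 0

/-- The special Euclidean group: affine isometries of the plane whose linear part has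
determinant one, i.e. compositions of rotations and translations. -/
def SE2 : Set (Plane ≃ᵃⁱ[ℝ] Plane) :=
  {g | LinearMap.det (g.linearIsometryEquiv.toLinearEquiv : Plane →ₗ[ℝ] Plane) = 1}

/-- `γ` is a regular `C³` periodic parametrization of a simple closed curve, which it traverses
exactly once in each period `L`. -/
structure IsSimpleClosed (γ : ℝ → Plane) (L : ℝ) : Prop where
  contDiff : ContDiff ℝ 3 γ
  regular : ∀ t, deriv γ t ≠ 0
  pos : 0 < L
  periodic : Function.Periodic γ L
  injOn : InjOn γ (Ico 0 L)

section Signature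

/-- Signed Euclidean curvature of the parametrized curve `γ` at the parameter `t`. -/
noncomputable def curvature (γ : ℝ → Plane) (t : ℝ) : ℝ :=
  det2 (deriv γ t) (deriv (deriv γ) t) / ‖deriv γ t‖ ^ 3

/-- The derivative of the curvature with respect to arc length. -/
noncomputable def curvatureDot (γ : ℝ → Plane) (t : ℝ) : ℝ :=
  deriv (curvature γ) t / ‖deriv γ t‖

/-- The parametrized signature map `t ↦ (κ(t), κ̇(t))`. -/
noncomputable def paramSignature (γ : ℝ → Plane) (t : ℝ) : Plane :=
  !₂[curvature γ t, curvatureDot γ t]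

/-- The unit tangent vector at the parameter `t`. -/
noncomputable def paramTangent (γ : ℝ → Plane) (t : ℝ) : Plane :=
  ‖deriv γ t‖⁻¹ • deriv γ t

/-- The curve `Γ` as a subset of the plane. -/
def curve (γ : ℝ → Plane) : Set Plane := range γ

/-- The signature map `p ↦ (κ(p), κ̇(p))` on the points `p` of `Γ` (its value outside `Γ` is
irrelevant and never used). -/
noncomputable def signatureMap (γ : ℝ → Plane) (p : Plane) : Plane :=
  paramSignature γ (Function.invFun γ p)

/-- The unit tangent vector at the points `p` of `Γ`; it records the orientation of `Γ` (its
value outside `Γ` is irrelevant and never used). -/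
noncomputable def tangent (γ : ℝ → Plane) (p : Plane) : Plane :=
  paramTangent γ (Function.invFun γ p)

/-- The signature of `Γ`: the image of the signature map. -/
noncomputable def signature (γ : ℝ → Plane) : Set Plane := signatureMap γ '' curve γ

/-- The vertices of `Γ`: the points at which `κ̇` vanishes. -/
noncomputable def vertices (γ : ℝ → Plane) : Set Plane :=
  {p | p ∈ curve γ ∧ signatureMap γ p 1 = 0}

/-- `Γ` is non-degenerate: each of its vertices is isolated. -/
def IsNondegenerate (γ : ℝ → Plane) : Prop :=
  ∀ p ∈ vertices γ, ∃ U : Set Plane, IsOpen U ∧ U ∩ vertices γ = {p}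

end Signature

section WellDefined

variable {γ : ℝ → Plane} {L : ℝ}

theorem IsSimpleClosed.exists_int (h : IsSimpleClosed γ L) {s t : ℝ} (hst : γ s = γ t) :
    ∃ n : ℤ, s = t + n * L := by
  have hs := toIcoMod_mem_Ico h.pos 0 s
  have ht := toIcoMod_mem_Ico h.pos 0 t
  rw [zero_add] at hs ht
  have e : ∀ r, γ (toIcoMod h.pos 0 r) = γ r := fun r => by
    rw [toIcoMod, h.periodic.sub_zsmul_eq]
  have key := h.injOn hs ht (by rw [e, e, hst])
  refine ⟨toIcoDiv h.pos 0 s - toIcoDiv h.pos 0 t, ?_⟩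
  simp only [toIcoMod, zsmul_eq_mul] at key
  push_cast
  linarith

theorem periodic_deriv {E : Type*} [NormedAddCommGroup E] [NormedSpace ℝ E] {f : ℝ → E} {c : ℝ}
    (h : Function.Periodic f c) : Function.Periodic (deriv f) c := fun t => by
  rw [← deriv_comp_add_const, h.funext]

theorem periodic_curvature (h : Function.Periodic γ L) :
    Function.Periodic (curvature γ) L := fun t => by
  simp only [curvature, periodic_deriv h t, periodic_deriv (periodic_deriv h) t]

theorem periodic_paramSignature (h : Function.Periodic γ L) :
    Function.Periodic (paramSignature γ) L := fun t => by
  simp only [paramSignature, curvatureDot, periodic_curvature h t,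
    periodic_deriv (periodic_curvature h) t, periodic_deriv h t]

theorem periodic_paramTangent (h : Function.Periodic γ L) :
    Function.Periodic (paramTangent γ) L := fun t => by
  simp only [paramTangent, periodic_deriv h t]

/-- The signature map of a simple closed curve satisfies `σ_Γ ∘ γ = σ_γ`. -/
theorem IsSimpleClosed.signatureMap_apply (h : IsSimpleClosed γ L) (t : ℝ) :
    signatureMap γ (γ t) = paramSignature γ t := by
  obtain ⟨n, hn⟩ := h.exists_int (Function.invFun_eq (f := γ) ⟨t, rfl⟩)
  rw [signatureMap, hn]
  exact (periodic_paramSignature h.periodic).int_mul n t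

/-- The unit tangent field of a simple closed curve satisfies `T_Γ ∘ γ = T_γ`. -/
theorem IsSimpleClosed.tangent_apply (h : IsSimpleClosed γ L) (t : ℝ) :
    tangent γ (γ t) = paramTangent γ t := by
  obtain ⟨n, hn⟩ := h.exists_int (Function.invFun_eq (f := γ) ⟨t, rfl⟩)
  rw [tangent, hn]
  exact (periodic_paramTangent h.periodic).int_mul n t

end WellDefined

section Topology

/-- `p` is a simple point of `A`: some open set around `p` meets `A` in a set homeomorphic to the
line or to a half-open interval. -/
def IsSimplePoint (A : Set Plane) (p : Plane) : Prop :=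
  ∃ V : Set Plane, IsOpen V ∧ p ∈ V ∧
    (Nonempty (↥(V ∩ A) ≃ₜ ℝ) ∨ Nonempty (↥(V ∩ A) ≃ₜ ↥(Ico (0 : ℝ) 1)))

/-- The points of self-intersection of `A`: those that are not simple. -/
def selfIntersections (A : Set Plane) : Set Plane := {p | p ∈ A ∧ ¬ IsSimplePoint A p}

/-- The set of connected components of a subset `A` of the plane. -/
def components (A : Set Plane) : Set (Set Plane) := connectedComponentIn A '' A

/-- `A` is an open curve segment of the parametrized curve `c`: the image under `c` of an open
interval, homeomorphic to an open interval in the subspace topology. -/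
def IsOpenSegment (c : ℝ → Plane) (A : Set Plane) : Prop :=
  ∃ a b : ℝ, a < b ∧ A = c '' Ioo a b ∧ Nonempty (↥A ≃ₜ ↥(Ioo a b))

end Topology

section Indices

/-- The pieces `A` and `B` of the oriented curve `Γ` are congruent: some `g ∈ SE(2)` maps `A` onto
`B` and carries the orientation of `A` to that of `B`. -/
def Congruent (γ : ℝ → Plane) (A B : Set Plane) : Prop :=
  ∃ g ∈ SE2, g '' A = B ∧ ∀ q ∈ A, g.linearIsometryEquiv (tangent γ q) = tangent γ (g q)

/-- The local symmetries of the oriented curve `Γ` based at `p`: those `g ∈ SE(2)` such that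
`g · (Γ ∩ U) = Γ ∩ (g · U)`, as sets and with orientations, for some open `U` containing `p`. -/
def localSymmetries (γ : ℝ → Plane) (p : Plane) : Set (Plane ≃ᵃⁱ[ℝ] Plane) :=
  {g | g ∈ SE2 ∧ ∃ U : Set Plane, IsOpen U ∧ p ∈ U ∧
    g '' (curve γ ∩ U) = curve γ ∩ g '' U ∧
    ∀ q ∈ curve γ ∩ U, g.linearIsometryEquiv (tangent γ q) = tangent γ (g q)}

/-- The local symmetry index of `Γ` at `p`. -/
noncomputable def symIndexAt (γ : ℝ → Plane) (p : Plane) : ℕ∞ := (localSymmetries γ p).encard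

/-- The preimage `σ_Γ⁻¹(A)` of a set under the signature map of `Γ`. -/
noncomputable def signaturePreimage (γ : ℝ → Plane) (A : Set Plane) : Set Plane :=
  {q | q ∈ curve γ ∧ signatureMap γ q ∈ A}

/-- The local signature index of `Γ` at `p`. -/
noncomputable def sigIndexAt (γ : ℝ → Plane) (p : Plane) : ℕ∞ :=
  (signaturePreimage γ {signatureMap γ p}).encard

/-- The global signature index of `Γ`: the minimum of the local ones (the infimum is attained,
since `ℕ∞` is well-ordered and `Γ` is non-empty). -/
noncomputable def sigIndex (γ : ℝ → Plane) : ℕ∞ := ⨅ p ∈ curve γ, sigIndexAt γ p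

end Indices

section Quiver

/-- The vertices of the signature quiver of `Γ`: the self-intersections of the signature. -/
noncomputable def quiverVertices (γ : ℝ → Plane) : Set Plane := selfIntersections (signature γ)

/-- The edges of the signature quiver of `Γ`: the connected components of the complement of the
self-intersection points in the signature. -/
noncomputable def quiverEdges (γ : ℝ → Plane) : Set (Set Plane) :=
  components (signature γ \ quiverVertices γ)

/-- The passages of `Γ` along the edge `E` during one period: the pairs `a < b` of consecutive
times at which `σ_γ` is at a quiver vertex, with `0 ≤ a < L`, such that `σ_γ` traces out `E` on the
interval `(a, b)`. Listed in the order of `a`, the intervals of all edges give the closed path that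
`Γ` induces on its quiver. -/
def passages (γ : ℝ → Plane) (L : ℝ) (E : Set Plane) : Set (ℝ × ℝ) :=
  {I | I.1 ∈ Ico 0 L ∧ I.1 < I.2 ∧
    paramSignature γ I.1 ∈ quiverVertices γ ∧ paramSignature γ I.2 ∈ quiverVertices γ ∧
    (∀ t ∈ Ioo I.1 I.2, paramSignature γ t ∉ quiverVertices γ) ∧
    paramSignature γ '' Ioo I.1 I.2 = E}

/-- The multiplicity of the edge `E` induced by `Γ`: how often the closed path induced by `Γ`
contains `E`. -/
noncomputable def multiplicity (γ : ℝ → Plane) (L : ℝ) (E : Set Plane) : ℕ∞ :=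
  (passages γ L E).encard

end Quiver

end PlaneCurve

/-! Pass to an arc length parametrization `c` with curvature `k` and derivative `kd`. The signature
path `sig` is then `(k, k')`, so it records its own speed along the first axis. Hence if the path is
at the same point, not a crossing, at two times, then near these times it runs through the same germ
of the signature, and the change of parameter `φ` between the two passages satisfies `k ∘ φ = k` and
`kd ∘ φ = kd`. This forces `φ' = 1` away from vertices, so `φ` is a translation
(`eventually_sig_add`). Non-degeneracy makes `sig` locally injective even at vertices, and
simplicity of the point makes it open onto the signature; together they provide `φ`.

By connectedness, the coincidence propagates through a whole gap between consecutive visits to the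
crossings, up to its endpoints (`gap_translate`). So the signature images of two gaps are disjoint
or equal, and in the latter case the gaps differ by a translation. The images are therefore the
edges (`quiverEdges_eq`), and the arcs of the curve over an edge are the components of its preimage,
one for each passage (`components_signaturePreimage`).

Translated gaps carry the same curvature function, so their arcs are congruent by uniqueness for the
Frenet equation (`SE2_apply_of_curvature_eq`). A point over an edge has exactly one partner with the
same signature in each passage (`sigIndexAt_eq`), and the local symmetries at the point correspond
to these partners (`symIndexAt_eq`). At crossings only an inequality survives (`le_sigIndexAt`),
which is enough for the minimum. -/

namespace PlaneCurve

open Filter Topology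

/-! ### Calculus on the line: translations and local injectivity of `(f, f')`. -/

section Calculus

/-- Near `t`, `φ` is the local inverse of `F` composed with `H`. Continuity of `φ` suffices to
select that branch, which matters because local lifts are only known to be continuous. -/
theorem hasDerivAt_of_comp_eq {F F' φ H : ℝ → ℝ} {h t : ℝ}
    (hF : ∀ s, HasDerivAt F (F' s) s) (hF' : Continuous F') (hφ : ContinuousAt φ t)
    (hne : F' (φ t) ≠ 0) (hH : HasDerivAt H h t) (heq : ∀ᶠ r in 𝓝 t, F (φ r) = H r) :
    HasDerivAt φ (h / F' (φ t)) t := by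
  have hs : HasStrictDerivAt F (F' (φ t)) (φ t) :=
    hasStrictDerivAt_of_hasDerivAt_of_continuousAt (Eventually.of_forall hF) hF'.continuousAt
  have hl := hs.eventually_left_inverse hne
  have hd := (hs.to_localInverse hne).hasDerivAt
  rw [heq.self_of_nhds] at hd
  have hc := hd.comp t hH
  rw [div_eq_inv_mul]
  refine hc.congr_of_eventuallyEq ?_
  filter_upwards [heq, hφ.eventually hl] with r hr hr'
  simp only [Function.comp, ← hr]
  exact hr'.symm

/-- A function whose derivative is one off a single point is a translation. -/
theorem eventually_eq_translate {F F' φ H H' : ℝ → ℝ} {t₀ : ℝ}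
    (hF : ∀ s, HasDerivAt F (F' s) s) (hF' : Continuous F')
    (hH : ∀ t, HasDerivAt H (H' t) t)
    (hφ : ∀ᶠ t in 𝓝 t₀, ContinuousAt φ t) (heq : ∀ᶠ t in 𝓝 t₀, F (φ t) = H t)
    (hne : ∀ᶠ t in 𝓝[≠] t₀, F' (φ t) = H' t ∧ H' t ≠ 0) :
    ∀ᶠ t in 𝓝 t₀, φ t = φ t₀ + (t - t₀) := by
  rw [eventually_nhdsWithin_iff] at hne
  obtain ⟨ε, hε, hball⟩ :=
    Metric.eventually_nhds_iff_ball.1 (hφ.and (heq.eventually_nhds.and hne))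
  have hd : ∀ t ∈ Metric.ball t₀ ε, t ≠ t₀ → HasDerivAt (fun r => φ r - r) 0 t := by
    intro t ht h0
    obtain ⟨h1, h2, h3⟩ := hball t ht
    obtain ⟨h4, h5⟩ := h3 h0
    have := hasDerivAt_of_comp_eq hF hF' h1 (by rwa [h4]) (hH t) h2
    rw [h4, div_self h5] at this
    have := this.sub (hasDerivAt_id t)
    rwa [sub_self] at this
  have hc : ∀ t ∈ Metric.ball t₀ ε, ContinuousAt (fun r => φ r - r) t := fun t ht =>
    (hball t ht).1.sub continuousAt_id
  filter_upwards [Metric.ball_mem_nhds t₀ hε] with t ht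
  rw [Real.ball_eq_Ioo] at hd hc ht
  -- The derivative is unknown only at `t₀`, which is an endpoint of the interval in each
  -- application of the mean value theorem.
  have key : φ t - t = φ t₀ - t₀ := by
    rcases lt_trichotomy t t₀ with h | h | h
    · have sub : Icc t t₀ ⊆ Ioo (t₀ - ε) (t₀ + ε) := fun x hx =>
        ⟨ht.1.trans_le hx.1, by linarith [hx.2]⟩
      obtain ⟨c, -, hc'⟩ := exists_hasDerivAt_eq_slope (fun r => φ r - r) (fun _ => 0) h
        (fun x hx => (hc x (sub hx)).continuousWithinAt)
        (fun x hx => hd x (sub (Ioo_subset_Icc_self hx)) hx.2.ne)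
      rw [eq_div_iff (by linarith)] at hc'
      linarith
    · rw [h]
    · have sub : Icc t₀ t ⊆ Ioo (t₀ - ε) (t₀ + ε) := fun x hx =>
        ⟨by linarith [hx.1], hx.2.trans_lt ht.2⟩
      obtain ⟨c, -, hc'⟩ := exists_hasDerivAt_eq_slope (fun r => φ r - r) (fun _ => 0) h
        (fun x hx => (hc x (sub hx)).continuousWithinAt)
        (fun x hx => hd x (sub (Ioo_subset_Icc_self hx)) hx.1.ne')
      rw [eq_div_iff (by linarith)] at hc'
      linarith
  linarith

theorem mul_pos_of_continuous_ne_zero {f : ℝ → ℝ} {a b : ℝ} (hab : a ≤ b) (hf : Continuous f)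
    (h : ∀ x ∈ Icc a b, f x ≠ 0) : 0 < f a * f b := by
  by_contra hn
  have h0 : (0 : ℝ) ∈ uIcc (f a) (f b) := by
    rw [mem_uIcc]
    have ha := h a (left_mem_Icc.2 hab)
    rcases lt_or_gt_of_ne ha with ha | ha
    · exact Or.inl ⟨ha.le, by nlinarith⟩
    · exact Or.inr ⟨by nlinarith, ha.le⟩
  obtain ⟨x, hx, hx0⟩ := intermediate_value_uIcc (hf.continuousOn (s := uIcc a b)) h0
  rw [uIcc_of_le hab] at hx
  exact h x hx hx0

/-- If `f'` has at most one zero in a neighbourhood of `s`, then `(f, f')` is injective there. -/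
theorem eq_of_eq_of_deriv_eq {f f' : ℝ → ℝ} {I : Set ℝ} {s x y : ℝ}
    (hf : ∀ t, HasDerivAt f (f' t) t) (hf' : Continuous f') (hI : I.OrdConnected)
    (hne : ∀ t ∈ I, t ≠ s → f' t ≠ 0) (hx : x ∈ I) (hy : y ∈ I) (h : f x = f y)
    (h' : f' x = f' y) : x = y := by
  wlog hxy : x < y generalizing x y
  · rcases (not_lt.1 hxy).eq_or_lt with h0 | h0
    · exact h0.symm
    · exact (this hy hx h.symm h'.symm h0).symm
  exfalso
  have hcf : Continuous f := continuous_iff_continuousAt.2 fun t => (hf t).continuousAt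
  have hsub : Icc x y ⊆ I := hI.out hx hy
  obtain ⟨z, hz, hz0⟩ := exists_hasDerivAt_eq_zero hxy hcf.continuousOn h fun t _ => hf t
  have hzs : z = s := by
    by_contra hzs
    exact hne z (hsub (Ioo_subset_Icc_self hz)) hzs hz0
  subst hzs
  -- The mean slopes on both sides of the zero `z` have the signs of `f' x` and `f' y`. These values
  -- agree, so `f` moves in the same direction on both sides and cannot return to its initial value.
  obtain ⟨u, hu, hu'⟩ := exists_hasDerivAt_eq_slope f f' hz.1 hcf.continuousOn fun t _ => hf t
  obtain ⟨v, hv, hv'⟩ := exists_hasDerivAt_eq_slope f f' hz.2 hcf.continuousOn fun t _ => hf t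
  have p1 := mul_pos_of_continuous_ne_zero hu.1.le hf' fun t ht =>
    hne t (hsub ⟨ht.1, ht.2.trans (hu.2.le.trans hz.2.le)⟩) (ht.2.trans_lt hu.2).ne
  have p2 := mul_pos_of_continuous_ne_zero hv.2.le hf' fun t ht =>
    hne t (hsub ⟨hz.1.le.trans (hv.1.le.trans ht.1), ht.2⟩) (hv.1.trans_le ht.1).ne'
  rw [eq_div_iff (by linarith [hz.1])] at hu'
  rw [eq_div_iff (by linarith [hz.2])] at hv'
  have q1 : 0 < z - x := by linarith [hz.1]
  have q2 : 0 < y - z := by linarith [hz.2]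
  have hsum : f' u * (z - x) + f' v * (y - z) = 0 := by rw [hu', hv', h]; ring
  rw [← h'] at p2
  have : 0 < f' x * (f' u * (z - x) + f' v * (y - z)) := by
    have := mul_pos p1 q1
    have := mul_pos p2 q2
    nlinarith
  rw [hsum] at this
  simp at this

end Calculus

/-! ### Paths open onto their image, local lifts, and components from covers. -/

section Topology

/-- A continuous function on a subset of the line that is injective near `s` maps neighbourhoods
of `s` to neighbourhoods. -/
theorem image_mem_nhds_of_injOn {f : ℝ → ℝ} {a b s : ℝ} (hs : s ∈ Ioo a b)
    (hc : ContinuousOn f (Icc a b)) (hi : InjOn f (Icc a b)) : f '' Icc a b ∈ 𝓝 (f s) := by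
  have hab : a ≤ b := (hs.1.trans hs.2).le
  have hs' := Ioo_subset_Icc_self hs
  rcases hc.strictMonoOn_of_injOn_Icc' hab hi with h | h
  · have h1 := h (left_mem_Icc.2 hab) hs' hs.1
    have h2 := h hs' (right_mem_Icc.2 hab) hs.2
    exact mem_of_superset (Icc_mem_nhds h1 h2) (intermediate_value_Icc hab hc)
  · have h1 := h (left_mem_Icc.2 hab) hs' hs.1
    have h2 := h hs' (right_mem_Icc.2 hab) hs.2
    exact mem_of_superset (Icc_mem_nhds h2 h1) (intermediate_value_Icc' hab hc)

theorem exists_Icc_subset_of_mem_nhds {s : ℝ} {N : Set ℝ} (hN : N ∈ 𝓝 s) :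
    ∃ a b, s ∈ Ioo a b ∧ Icc a b ⊆ N := by
  obtain ⟨ε, hε, h⟩ := Metric.nhds_basis_closedBall.mem_iff.1 hN
  rw [Real.closedBall_eq_Icc] at h
  exact ⟨s - ε, s + ε, ⟨by linarith, by linarith⟩, h⟩

variable {X : Type*} [TopologicalSpace X]

/-- A locally injective path in `A` is open onto `A` at `s`, if a neighbourhood of `f s` in `A` has
a continuous injection into the line. -/
theorem nhdsWithin_le_map_of_injOn {f : ℝ → X} {s : ℝ} {A V : Set X} {N : Set ℝ}
    (hf : Continuous f) (hA : ∀ t, f t ∈ A) (hN : N ∈ 𝓝 s) (hi : InjOn f N)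
    (hV : IsOpen V) (hs : f s ∈ V) {e : ↥(V ∩ A) → ℝ} (he : Continuous e)
    (hei : Function.Injective e) : 𝓝[A] (f s) ≤ map f (𝓝 s) := by
  intro W hW
  rw [mem_map] at hW
  obtain ⟨a, b, hab, hsub⟩ := exists_Icc_subset_of_mem_nhds
    (inter_mem (inter_mem hW hN) (hf.continuousAt.preimage_mem_nhds (hV.mem_nhds hs)))
  classical
  -- The path read in the chart `e`; the value `0` is never used, as `f` maps `[a, b]` into `V ∩ A`.
  -- An injective continuous real function covers a neighbourhood, which is pulled back through `e`.
  let g : ℝ → ℝ := fun t => if h : f t ∈ V ∩ A then e ⟨f t, h⟩ else 0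
  have hmem : ∀ t ∈ Icc a b, f t ∈ V ∩ A := fun t ht => ⟨(hsub ht).2, hA t⟩
  have hg : ∀ t (ht : t ∈ Icc a b), g t = e ⟨f t, hmem t ht⟩ := fun t ht => dif_pos (hmem t ht)
  have hgc : ContinuousOn g (Icc a b) := by
    rw [continuousOn_iff_continuous_domRestrict]
    have : (Icc a b).domRestrict g = fun t : Icc a b => e ⟨f t, hmem t t.2⟩ := by
      funext t; exact hg t t.2
    rw [this]
    exact he.comp ((hf.comp continuous_subtype_val).subtype_mk _)
  have hgi : InjOn g (Icc a b) := by
    intro x hx y hy hxy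
    rw [hg x hx, hg y hy] at hxy
    exact hi (hsub hx).1.2 (hsub hy).1.2 (congrArg Subtype.val (hei hxy))
  have hnb := image_mem_nhds_of_injOn hab hgc hgi
  have hs' := Ioo_subset_Icc_self hab
  rw [hg s hs'] at hnb
  have hpre := he.continuousAt.preimage_mem_nhds hnb
  rw [mem_nhds_subtype_iff_nhdsWithin] at hpre
  have hpre' : Subtype.val '' (e ⁻¹' (g '' Icc a b)) ∈ 𝓝[A] (f s) := by
    rwa [nhdsWithin_inter_of_mem (mem_nhdsWithin_of_mem_nhds (hV.mem_nhds hs))] at hpre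
  refine mem_of_superset hpre' ?_
  rintro _ ⟨q, ⟨t, ht, htq⟩, rfl⟩
  rw [hg t ht] at htq
  rw [← hei htq]
  exact (hsub ht).1.1

/-- Paths into the image of a path `f` lift locally through `f` where `f` is injective and open
onto its image. -/
theorem exists_local_lift {f h : ℝ → X} {x t₀ : ℝ} {I : Set ℝ} (hI : IsOpen I) (hx : x ∈ I)
    (hi : InjOn f I) (ho : ∀ s ∈ I, 𝓝[range f] (f s) ≤ map f (𝓝 s)) (hh : Continuous h)
    (hr : ∀ᶠ t in 𝓝 t₀, h t ∈ range f) (h0 : h t₀ = f x) :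
    ∃ φ : ℝ → ℝ, φ t₀ = x ∧ ∀ᶠ t in 𝓝 t₀, φ t ∈ I ∧ f (φ t) = h t ∧ ContinuousAt φ t := by
  have step : ∀ t y, h t = f y → y ∈ I → (∀ᶠ r in 𝓝 t, h r ∈ range f) → ∀ N ∈ 𝓝 y,
      ∀ᶠ r in 𝓝 t, h r ∈ f '' N := by
    intro t y hty hy hrt N hN
    have : Tendsto h (𝓝 t) (𝓝[range f] (f y)) :=
      tendsto_nhdsWithin_iff.2 ⟨hty ▸ hh.continuousAt, hrt⟩
    exact this (ho y hy (image_mem_map hN))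
  -- Any choice of preimage in `I` serves as the lift: injectivity makes it unique, and openness of
  -- `f` onto its range, used through `step`, makes it continuous.
  have hev := step t₀ x h0 hx hr I (hI.mem_nhds hx)
  have hsp : ∀ t, h t ∈ f '' I → Function.invFunOn f I (h t) ∈ I ∧
      f (Function.invFunOn f I (h t)) = h t := fun t ht =>
    ⟨Function.invFunOn_mem ht, Function.invFunOn_eq ht⟩
  refine ⟨fun t => Function.invFunOn f I (h t), ?_, ?_⟩
  · obtain ⟨h1, h2⟩ := hsp t₀ ⟨x, hx, h0.symm⟩
    exact hi h1 hx (h2.trans h0)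
  · filter_upwards [hev.eventually_nhds, hr.eventually_nhds] with t ht hrt
    obtain ⟨h1, h2⟩ := hsp t ht.self_of_nhds
    refine ⟨h1, h2, fun N hN => ?_⟩
    have := step t _ h2.symm h1 hrt (N ∩ I) (inter_mem hN (hI.mem_nhds h1))
    rw [mem_map]
    filter_upwards [this] with r hr'
    obtain ⟨y, ⟨hyN, hyI⟩, hy⟩ := hr'
    obtain ⟨h3, h4⟩ := hsp r ⟨y, hyI, hy⟩
    have : Function.invFunOn f I (h r) = y := hi h3 hyI (h4.trans hy.symm)
    simpa [this] using hyN

/-- A set covered by a family of relatively open preconnected sets any two of which are equal or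
disjoint has these sets as its connected components. -/
theorem connectedComponentIn_eq_of_cover {Y : Set X} {F : Set (Set X)} (hU : ⋃₀ F = Y)
    (hc : ∀ A ∈ F, IsPreconnected A) (ho : ∀ A ∈ F, ∀ q ∈ A, A ∈ 𝓝[Y] q)
    (hd : ∀ A ∈ F, ∀ B ∈ F, (A ∩ B).Nonempty → A = B) {A : Set X} (hA : A ∈ F) {q : X}
    (hq : q ∈ A) : connectedComponentIn Y q = A := by
  have hAY : ∀ B ∈ F, B ⊆ Y := fun B hB => hU ▸ subset_sUnion_of_mem hB
  refine Subset.antisymm ?_ ((hc A hA).subset_connectedComponentIn hq (hAY A hA))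
  have hopen : ∀ B : Set X, (∀ q ∈ B, B ∈ 𝓝[Y] q) → ∃ O, IsOpen O ∧ B ⊆ O ∧ O ∩ Y ⊆ B := by
    intro B hB
    refine ⟨⋃₀ {O | IsOpen O ∧ O ∩ Y ⊆ B}, isOpen_sUnion fun O hO => hO.1, ?_, ?_⟩
    · intro z hz
      obtain ⟨O, hO, hzO, hOB⟩ := mem_nhdsWithin.1 (hB z hz)
      exact ⟨O, ⟨hO, hOB⟩, hzO⟩
    · rintro z ⟨⟨O, hO, hzO⟩, hzY⟩
      exact hO.2 ⟨hzO, hzY⟩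
  obtain ⟨O₁, hO₁, hA₁, hO₁A⟩ := hopen A (ho A hA)
  obtain ⟨O₂, hO₂, hA₂, hO₂A⟩ := hopen (Y \ A) (by
    rintro z ⟨hzY, hzA⟩
    rw [← hU] at hzY
    obtain ⟨B, hB, hzB⟩ := hzY
    refine mem_of_superset (ho B hB z hzB) fun w hw => ⟨hAY B hB hw, fun hwA => hzA ?_⟩
    rwa [hd A hA B hB ⟨w, hwA, hw⟩])
  intro z hz
  have hYs := connectedComponentIn_subset Y q
  by_contra hzA
  obtain ⟨w, hw, hw1, hw2⟩ := isPreconnected_connectedComponentIn (F := Y) (x := q) O₁ O₂ hO₁ hO₂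
    (fun w hw => by
      by_cases h : w ∈ A
      · exact Or.inl (hA₁ h)
      · exact Or.inr (hA₂ ⟨hYs hw, h⟩))
    ⟨q, mem_connectedComponentIn (hAY A hA hq), hA₁ hq⟩ ⟨z, hz, hA₂ ⟨hYs hz, hzA⟩⟩
  exact (hO₂A ⟨hw2, hYs hw⟩).2 (hO₁A ⟨hw1, hYs hw⟩)

theorem image_connectedComponentIn_eq_of_cover {Y : Set X} {F : Set (Set X)} (hU : ⋃₀ F = Y)
    (hne : ∀ A ∈ F, A.Nonempty)
    (hc : ∀ A ∈ F, IsPreconnected A) (ho : ∀ A ∈ F, ∀ q ∈ A, A ∈ 𝓝[Y] q)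
    (hd : ∀ A ∈ F, ∀ B ∈ F, (A ∩ B).Nonempty → A = B) :
    connectedComponentIn Y '' Y = F := by
  ext A
  constructor
  · rintro ⟨q, hq, rfl⟩
    rw [← hU] at hq
    obtain ⟨B, hB, hqB⟩ := hq
    rwa [connectedComponentIn_eq_of_cover hU hc ho hd hB hqB]
  · intro hA
    obtain ⟨q, hq⟩ := hne A hA
    exact ⟨q, hU ▸ mem_sUnion_of_mem hq hA, connectedComponentIn_eq_of_cover hU hc ho hd hA hq⟩

/-- A path that is injective on an interval and open onto its image there maps that interval
homeomorphically onto its image. -/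
theorem nonempty_homeomorph_image_Ioo {f : ℝ → X} {a b : ℝ} (hf : Continuous f)
    (hi : InjOn f (Ioo a b)) (ho : ∀ s ∈ Ioo a b, 𝓝[range f] (f s) ≤ map f (𝓝 s)) :
    Nonempty (↥(f '' Ioo a b) ≃ₜ ↥(Ioo a b)) := by
  let e : ↥(Ioo a b) ≃ ↥(f '' Ioo a b) := Equiv.Set.imageOfInjOn f _ hi
  have hec : Continuous e := (hf.comp continuous_subtype_val).subtype_mk _
  refine ⟨(e.toHomeomorphOfContinuousOpen hec ?_).symm⟩
  rw [isOpenMap_iff_nhds_le]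
  intro x W hW
  rw [mem_map, mem_nhds_subtype_iff_nhdsWithin,
    isOpen_Ioo.nhdsWithin_eq x.2] at hW
  rw [mem_nhds_subtype_iff_nhdsWithin]
  have := nhdsWithin_mono _ (image_subset_range f (Ioo a b)) (ho x x.2 (image_mem_map hW))
  refine mem_of_superset this ?_
  rintro _ ⟨_, ⟨y, hy, rfl⟩, rfl⟩
  exact ⟨e y, hy, rfl⟩

end Topology

/-! ### Rotations and the group `SE2`. -/

section Rotation

noncomputable instance : Fact (Module.finrank ℝ Plane = 2) := ⟨by simp⟩

/-- The standard orientation of the plane. -/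
noncomputable def planeOrientation : Orientation ℝ Plane (Fin 2) :=
  (EuclideanSpace.basisFun (Fin 2) ℝ).toBasis.orientation

/-- The rotation of the plane by a right angle. -/
noncomputable def quarterTurn : Plane ≃ₗᵢ[ℝ] Plane := planeOrientation.rightAngleRotation

theorem inner_quarterTurn_left (u v : Plane) : inner ℝ (quarterTurn u) v = det2 u v := by
  rw [quarterTurn, Orientation.inner_rightAngleRotation_left, Orientation.areaForm_to_volumeForm,
    planeOrientation.volumeForm_robust (EuclideanSpace.basisFun (Fin 2) ℝ) rfl,
    Module.Basis.det_apply, Matrix.det_fin_two]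
  simp [Module.Basis.toMatrix_apply, det2]
  ring

theorem inner_quarterTurn_self (u : Plane) : inner ℝ (quarterTurn u) u = 0 := by
  rw [inner_quarterTurn_left, det2]; ring

theorem quarterTurn_comm {g : Plane ≃ᵃⁱ[ℝ] Plane} (hg : g ∈ SE2) (u : Plane) :
    g.linearIsometryEquiv (quarterTurn u) = quarterTurn (g.linearIsometryEquiv u) :=
  planeOrientation.linearIsometryEquiv_comp_rightAngleRotation _
    ((show _ = (1 : ℝ) from hg) ▸ one_pos) u

theorem exists_SE2 (p q : Plane) {u v : Plane} (huv : ‖u‖ = ‖v‖) :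
    ∃ g ∈ SE2, g p = q ∧ g.linearIsometryEquiv u = v := by
  let R := planeOrientation.rotation (planeOrientation.oangle u v)
  refine ⟨(R.toAffineIsometryEquiv.trans (AffineIsometryEquiv.constVAdd ℝ Plane (q - R p))), ?_,
    ?_, ?_⟩
  · exact planeOrientation.det_rotation _
  · simp
  · exact (planeOrientation.rotation_oangle_eq_iff_norm_eq u v).2 huv

/-- The linear parts are rotations, and the angle of a rotation is the oriented angle from a nonzero
vector to its image. -/
theorem SE2_ext {g g' : Plane ≃ᵃⁱ[ℝ] Plane} (hg : g ∈ SE2) (hg' : g' ∈ SE2) {p u : Plane}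
    (hu : u ≠ 0) (hp : g p = g' p) (h : g.linearIsometryEquiv u = g'.linearIsometryEquiv u) :
    g = g' := by
  obtain ⟨θ, hθ⟩ := planeOrientation.exists_linearIsometryEquiv_eq_of_det_pos
    (f := g.linearIsometryEquiv) ((show _ = (1 : ℝ) from hg) ▸ one_pos)
  obtain ⟨θ', hθ'⟩ := planeOrientation.exists_linearIsometryEquiv_eq_of_det_pos
    (f := g'.linearIsometryEquiv) ((show _ = (1 : ℝ) from hg') ▸ one_pos)
  have hl : g.linearIsometryEquiv = g'.linearIsometryEquiv := by
    rw [hθ, hθ'] at h ⊢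
    have e1 := planeOrientation.oangle_rotation_self_right hu θ
    have e2 := planeOrientation.oangle_rotation_self_right hu θ'
    rw [← e1, h, e2]
  ext1 x
  have e := g.map_vadd p (x -ᵥ p)
  have e' := g'.map_vadd p (x -ᵥ p)
  rw [vsub_vadd] at e e'
  rw [e, e', hl, hp]

end Rotation

/-! ### Curves parametrized by arc length and the gaps of their signature path. -/

/-- A closed curve `c` parametrized by arc length, with unit tangent `T`, curvature `k` and
derivative `kd` of the curvature, whose vertices are isolated, and which is simple with
period `P`. -/
structure IsFramed (c T : ℝ → Plane) (k kd : ℝ → ℝ) (P : ℝ) : Prop where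
  pos : 0 < P
  periodic_c : Function.Periodic c P
  periodic_T : Function.Periodic T P
  periodic_k : Function.Periodic k P
  periodic_kd : Function.Periodic kd P
  exists_int : ∀ s t, c s = c t → ∃ n : ℤ, s = t + n * P
  norm_T : ∀ s, ‖T s‖ = 1
  deriv_c : ∀ s, HasDerivAt c (T s) s
  deriv_T : ∀ s, HasDerivAt T (k s • quarterTurn (T s)) s
  deriv_k : ∀ s, HasDerivAt k (kd s) s
  continuous_kd : Continuous kd
  isolated : ∀ s, ∀ᶠ t in 𝓝[≠] s, kd t ≠ 0

/-- The path with coordinates `k` and `kd`. -/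
noncomputable def sig (k kd : ℝ → ℝ) (s : ℝ) : Plane := !₂[k s, kd s]

theorem sig_eq_iff {k kd : ℝ → ℝ} {s t : ℝ} :
    sig k kd s = sig k kd t ↔ k s = k t ∧ kd s = kd t := by
  constructor
  · intro h
    exact ⟨congrFun (congrArg WithLp.ofLp h) 0, congrFun (congrArg WithLp.ofLp h) 1⟩
  · rintro ⟨h, h'⟩
    rw [sig, sig, h, h']

/-- `a < b` are consecutive times at which the path `σ` is in `Q`. -/
def IsGap (σ : ℝ → Plane) (Q : Set Plane) (a b : ℝ) : Prop :=
  a < b ∧ σ a ∈ Q ∧ σ b ∈ Q ∧ ∀ t ∈ Ioo a b, σ t ∉ Q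

/-- Gaps starting at the same time agree. -/
theorem IsGap.right_unique {σ : ℝ → Plane} {Q : Set Plane} {a b b' : ℝ}
    (hg : IsGap σ Q a b) (hg' : IsGap σ Q a b') : b = b' := by
  rcases lt_trichotomy b b' with hlt | heq | hlt
  · exact absurd hg.2.2.1 (hg'.2.2.2 b ⟨hg.1, hlt⟩)
  · exact heq
  · exact absurd hg'.2.2.1 (hg.2.2.2 b' ⟨hg'.1, hlt⟩)

theorem IsGap.add_int_mul {σ : ℝ → Plane} {Q : Set Plane} {a b p : ℝ}
    (hg : IsGap σ Q a b) (hσ : Function.Periodic σ p) (n : ℤ) :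
    IsGap σ Q (a + n * p) (b + n * p) := by
  have e := fun t => hσ.int_mul n t
  refine ⟨by linarith [hg.1], by rw [e]; exact hg.2.1, by rw [e]; exact hg.2.2.1, fun t ht => ?_⟩
  have := e (t - n * p)
  rw [sub_add_cancel] at this
  rw [this]
  exact hg.2.2.2 _ ⟨by linarith [ht.1], by linarith [ht.2]⟩

namespace IsFramed

variable {c T : ℝ → Plane} {k kd : ℝ → ℝ} {P : ℝ}

theorem continuous_k (h : IsFramed c T k kd P) : Continuous k :=
  continuous_iff_continuousAt.2 fun s => (h.deriv_k s).continuousAt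

theorem continuous_c (h : IsFramed c T k kd P) : Continuous c :=
  continuous_iff_continuousAt.2 fun s => (h.deriv_c s).continuousAt

theorem continuous_T (h : IsFramed c T k kd P) : Continuous T :=
  continuous_iff_continuousAt.2 fun s => (h.deriv_T s).continuousAt

theorem continuous_sig (h : IsFramed c T k kd P) : Continuous (sig k kd) := by
  have h1 := h.continuous_k
  have h2 := h.continuous_kd
  unfold sig
  fun_prop

theorem periodic_sig (h : IsFramed c T k kd P) : Function.Periodic (sig k kd) P := fun s =>
  sig_eq_iff.2 ⟨h.periodic_k s, h.periodic_kd s⟩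

theorem exists_injOn (h : IsFramed c T k kd P) (s : ℝ) :
    ∃ I, IsOpen I ∧ s ∈ I ∧ InjOn (sig k kd) I ∧ ∀ t ∈ I, t ≠ s → kd t ≠ 0 := by
  have := h.isolated s
  rw [eventually_nhdsWithin_iff] at this
  obtain ⟨ε, hε, hb⟩ := Metric.eventually_nhds_iff_ball.1 this
  refine ⟨Metric.ball s ε, Metric.isOpen_ball, Metric.mem_ball_self hε, ?_, hb⟩
  intro x hx y hy hxy
  obtain ⟨h1, h2⟩ := sig_eq_iff.1 hxy
  exact eq_of_eq_of_deriv_eq h.deriv_k h.continuous_kd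
    (by rw [Real.ball_eq_Ioo]; exact ordConnected_Ioo) hb hx hy h1 h2

/-- Both models of a simple point inject continuously into the line, so local injectivity of the
path gives openness. -/
theorem sig_nhdsWithin_le (h : IsFramed c T k kd P) {s : ℝ}
    (hs : sig k kd s ∉ selfIntersections (range (sig k kd))) :
    𝓝[range (sig k kd)] (sig k kd s) ≤ map (sig k kd) (𝓝 s) := by
  have hsp : IsSimplePoint (range (sig k kd)) (sig k kd s) := by
    by_contra hn
    exact hs ⟨mem_range_self s, hn⟩
  obtain ⟨I, hI, hsI, hi, -⟩ := h.exists_injOn s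
  obtain ⟨V, hV, hsV, ⟨⟨e⟩⟩ | ⟨⟨e⟩⟩⟩ := hsp
  · exact nhdsWithin_le_map_of_injOn h.continuous_sig mem_range_self (hI.mem_nhds hsI) hi hV hsV
      e.continuous e.injective
  · exact nhdsWithin_le_map_of_injOn h.continuous_sig mem_range_self (hI.mem_nhds hsI) hi hV hsV
      (continuous_subtype_val.comp e.continuous) (Subtype.val_injective.comp e.injective)

/-- At two times at which the path `σ` is at the same point, not a self-intersection, it runs
through the same curve at the same speed. -/
theorem eventually_sig_add (h : IsFramed c T k kd P)
    (hfin : (selfIntersections (range (sig k kd))).Finite) {t d : ℝ}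
    (ht : sig k kd t ∉ selfIntersections (range (sig k kd)))
    (htd : sig k kd (t + d) = sig k kd t) :
    ∀ᶠ r in 𝓝 t, sig k kd (r + d) = sig k kd r := by
  obtain ⟨I, hI, htI, hi, hk⟩ := h.exists_injOn (t + d)
  obtain ⟨I', hI', htI', hi', hk'⟩ := h.exists_injOn t
  have hopen : IsOpen (sig k kd ⁻¹' (selfIntersections (range (sig k kd)))ᶜ) :=
    hfin.isClosed.isOpen_compl.preimage h.continuous_sig
  obtain ⟨φ, hφ0, hφ⟩ := exists_local_lift (f := sig k kd) (h := sig k kd) (x := t + d) (t₀ := t)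
    (hI.inter hopen)
    ⟨htI, by rw [mem_preimage, htd]; exact ht⟩ (hi.mono inter_subset_left)
    (fun s hs => h.sig_nhdsWithin_le hs.2) h.continuous_sig
    (Eventually.of_forall mem_range_self) htd.symm
  -- The first coordinate of the signature gives `k ∘ φ = k`, the second says that both sides have
  -- the same derivative factor; so `φ' = 1` where `kd ≠ 0`.
  have key := eventually_eq_translate (φ := φ) (t₀ := t) h.deriv_k h.continuous_kd h.deriv_k
    (hφ.mono fun r hr => hr.2.2) (hφ.mono fun r hr => (sig_eq_iff.1 hr.2.1).1) (by
      rw [eventually_nhdsWithin_iff]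
      filter_upwards [hφ, hI'.mem_nhds htI'] with r hr hrI hrt
      exact ⟨(sig_eq_iff.1 hr.2.1).2, hk' r hrI hrt⟩)
  filter_upwards [hφ, key] with r hr hr'
  rw [hφ0] at hr'
  rw [← hr.2.1, hr']
  congr 1
  ring

/-- The times near which the coincidence holds form an open set, relatively closed in the gap
because `eventually_sig_add` applies again at limit points. Continuity then adds the endpoints. -/
theorem sig_add_of_mem_Icc (h : IsFramed c T k kd P)
    (hfin : (selfIntersections (range (sig k kd))).Finite) {a b s d : ℝ}
    (hab : ∀ t ∈ Ioo a b, sig k kd t ∉ selfIntersections (range (sig k kd)))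
    (hs : s ∈ Ioo a b) (hsd : sig k kd (s + d) = sig k kd s) {t : ℝ} (ht : t ∈ Icc a b) :
    sig k kd (t + d) = sig k kd t := by
  have hcl : IsClosed {t | sig k kd (t + d) = sig k kd t} :=
    isClosed_eq (h.continuous_sig.comp (continuous_add_const d)) h.continuous_sig
  have hsub : Ioo a b ⊆ {t | ∀ᶠ r in 𝓝 t, sig k kd (r + d) = sig k kd r} := by
    refine isPreconnected_Ioo.subset_of_closure_inter_subset isOpen_setOfPred_eventually_nhds
      ⟨s, hs, h.eventually_sig_add hfin (hab s hs) hsd⟩ ?_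
    rintro t ⟨ht, htab⟩
    refine h.eventually_sig_add hfin (hab t htab) ?_
    exact closure_minimal (fun r hr => Eventually.self_of_nhds hr) hcl ht
  rw [← closure_Ioo (hs.1.trans hs.2).ne] at ht
  exact closure_minimal (fun r hr => Eventually.self_of_nhds (hsub hr)) hcl ht

theorem gap_translate (h : IsFramed c T k kd P)
    (hfin : (selfIntersections (range (sig k kd))).Finite) {a b a' b' s s' : ℝ}
    (hg : IsGap (sig k kd) (selfIntersections (range (sig k kd))) a b)
    (hg' : IsGap (sig k kd) (selfIntersections (range (sig k kd))) a' b')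
    (hs : s ∈ Ioo a b) (hs' : s' ∈ Ioo a' b') (hss : sig k kd s = sig k kd s') :
    a' - a = s' - s ∧ b' - b = s' - s ∧
      ∀ t ∈ Icc a b, sig k kd (t + (s' - s)) = sig k kd t := by
  obtain ⟨hab, ha, hb, hn⟩ := hg
  obtain ⟨hab', ha', hb', hn'⟩ := hg'
  have e1 : ∀ t ∈ Icc a b, sig k kd (t + (s' - s)) = sig k kd t := fun t ht =>
    h.sig_add_of_mem_Icc hfin hn hs (by rw [add_sub_cancel, hss]) ht
  have e2 : ∀ t ∈ Icc a' b', sig k kd (t + (s - s')) = sig k kd t := fun t ht =>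
    h.sig_add_of_mem_Icc hfin hn' hs' (by rw [add_sub_cancel, hss]) ht
  -- An endpoint of one gap, shifted, is still at a crossing, so it cannot fall inside the other
  -- gap. Shifting in both directions gives the two equalities.
  have i1 : a + (s' - s) ≤ a' := by
    by_contra! hlt
    refine hn' _ ⟨hlt, by linarith [hs.1, hs'.2]⟩ ?_
    rwa [e1 a (left_mem_Icc.2 hab.le)]
  have i2 : b' ≤ b + (s' - s) := by
    by_contra! hlt
    refine hn' _ ⟨by linarith [hs.2, hs'.1], hlt⟩ ?_
    rwa [e1 b (right_mem_Icc.2 hab.le)]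
  have i3 : a' + (s - s') ≤ a := by
    by_contra! hlt
    refine hn _ ⟨hlt, by linarith [hs'.1, hs.2]⟩ ?_
    rwa [e2 a' (left_mem_Icc.2 hab'.le)]
  have i4 : b ≤ b' + (s - s') := by
    by_contra! hlt
    refine hn _ ⟨by linarith [hs'.2, hs.1], hlt⟩ ?_
    rwa [e2 b' (right_mem_Icc.2 hab'.le)]
  exact ⟨by linarith, by linarith, e1⟩

theorem gap_injOn (h : IsFramed c T k kd P)
    (hfin : (selfIntersections (range (sig k kd))).Finite) {a b : ℝ}
    (hg : IsGap (sig k kd) (selfIntersections (range (sig k kd))) a b) :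
    InjOn (sig k kd) (Ioo a b) := by
  intro s hs s' hs' hss
  have := (h.gap_translate hfin hg hg hs hs' hss).1
  linarith

/-- Local injectivity bounds the visits to the finite set `Q` near each time, and the interval is
compact. -/
theorem finite_times (h : IsFramed c T k kd P) {Q : Set Plane} (hfin : Q.Finite) (a b : ℝ) :
    {t ∈ Icc a b | sig k kd t ∈ Q}.Finite := by
  refine (isCompact_Icc (a := a) (b := b)).induction_on
    (p := fun A => {t ∈ A | sig k kd t ∈ Q}.Finite) (by simp)
    (fun A B hAB hB => hB.subset fun t ht => ⟨hAB ht.1, ht.2⟩)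
    (fun A B hA hB => (hA.union hB).subset ?_) (fun s _ => ?_)
  · rintro t ⟨ht | ht, hQ⟩
    · exact Or.inl ⟨ht, hQ⟩
    · exact Or.inr ⟨ht, hQ⟩
  · obtain ⟨I, hI, hsI, hi, -⟩ := h.exists_injOn s
    exact ⟨I, mem_nhdsWithin_of_mem_nhds (hI.mem_nhds hsI),
      Set.Finite.of_finite_image (hfin.subset (by rintro _ ⟨t, ht, rfl⟩; exact ht.2))
        (hi.mono fun t ht => ht.1)⟩

theorem exists_gap_of_mem (h : IsFramed c T k kd P) {Q : Set Plane} (hfin : Q.Finite) {a : ℝ}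
    (ha : sig k kd a ∈ Q) : ∃ b, IsGap (sig k kd) Q a b := by
  have hf : {t ∈ Ioc a (a + P) | sig k kd t ∈ Q}.Finite :=
    (h.finite_times hfin a (a + P)).subset fun t ht => ⟨Ioc_subset_Icc_self ht.1, ht.2⟩
  obtain ⟨b, ⟨hb, hbQ⟩, hmin⟩ := exists_min_image _ id hf
    ⟨a + P, ⟨by linarith [h.pos], le_rfl⟩, by rwa [h.periodic_sig a]⟩
  refine ⟨b, hb.1, ha, hbQ, fun t ht htQ => ?_⟩
  have := hmin t ⟨⟨ht.1, ht.2.le.trans hb.2⟩, htQ⟩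
  simp only [id] at this
  linarith [ht.2]

theorem exists_gap_of_notMem (h : IsFramed c T k kd P) {Q : Set Plane} (hfin : Q.Finite)
    (hne : ∃ a, sig k kd a ∈ Q) {t : ℝ} (ht : sig k kd t ∉ Q) :
    ∃ a b, IsGap (sig k kd) Q a b ∧ t ∈ Ioo a b := by
  obtain ⟨a₀, ha₀⟩ := hne
  have hf : {r ∈ Icc (t - P) t | sig k kd r ∈ Q}.Finite := h.finite_times hfin _ _
  obtain ⟨n, hn⟩ : ∃ n : ℤ, a₀ + n * P ∈ Ioc (t - P) t := by
    obtain ⟨n, hn, -⟩ := existsUnique_add_zsmul_mem_Ioc h.pos a₀ (t - P)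
    rw [sub_add_cancel, zsmul_eq_mul] at hn
    exact ⟨n, hn⟩
  -- The gap around `t` starts at the last visit to `Q` before `t`.
  obtain ⟨a, ⟨ha, haQ⟩, hmax⟩ := exists_max_image _ id hf
    ⟨a₀ + n * P, Ioc_subset_Icc_self hn, by rwa [h.periodic_sig.int_mul n a₀]⟩
  obtain ⟨b, hb⟩ := h.exists_gap_of_mem hfin haQ
  have hat : a < t := ha.2.lt_of_ne (by rintro rfl; exact ht haQ)
  refine ⟨a, b, hb, hat, ?_⟩
  by_contra! hbt
  have := hmax b ⟨⟨by linarith [ha.1, hb.1], hbt⟩, hb.2.2.1⟩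
  simp only [id] at this
  linarith [hb.1]

theorem gap_le (h : IsFramed c T k kd P) {Q : Set Plane} {a b : ℝ}
    (hg : IsGap (sig k kd) Q a b) : b ≤ a + P := by
  by_contra! hlt
  refine hg.2.2.2 (a + P) ⟨by linarith [h.pos], hlt⟩ ?_
  rw [h.periodic_sig a]
  exact hg.2.1

theorem exists_int_mem_Ico (h : IsFramed c T k kd P) (a : ℝ) : ∃ n : ℤ, a + n * P ∈ Ico 0 P := by
  obtain ⟨n, hn, -⟩ := existsUnique_add_zsmul_mem_Ico h.pos a 0
  rw [zero_add, zsmul_eq_mul] at hn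
  exact ⟨n, hn⟩

theorem int_eq_zero (h : IsFramed c T k kd P) {a b : ℝ} {n : ℤ} (ha : a ∈ Ico 0 P)
    (hb : b ∈ Ico 0 P) (hab : a = b + n * P) : n = 0 := by
  have hP := h.pos
  have h1 : (n : ℝ) < 1 := by
    by_contra! hn
    nlinarith [ha.2, hb.1]
  have h2 : (-1 : ℝ) < n := by
    by_contra! hn
    nlinarith [ha.1, hb.2]
  have h1' : n < 1 := by exact_mod_cast h1
  have h2' : -1 < n := by exact_mod_cast h2
  omega

theorem c_injOn (h : IsFramed c T k kd P) (a : ℝ) : InjOn c (Ioo a (a + P)) := by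
  intro s hs t ht hst
  obtain ⟨n, hn⟩ := h.exists_int s t hst
  have hP := h.pos
  have h1 : (n : ℝ) < 1 := by
    by_contra! hn'
    nlinarith [hs.2, ht.1]
  have h2 : (-1 : ℝ) < n := by
    by_contra! hn'
    nlinarith [hs.1, ht.2]
  have h1' : n < 1 := by exact_mod_cast h1
  have h2' : -1 < n := by exact_mod_cast h2
  have : n = 0 := by omega
  simpa [this] using hn

/-- By compactness, the part of a simple closed curve away from the parameters near `s` keeps a
positive distance from `c s`. -/
theorem c_nhdsWithin_le (h : IsFramed c T k kd P) (s : ℝ) :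
    𝓝[range c] (c s) ≤ map c (𝓝 s) := by
  intro W hW
  rw [mem_map] at hW
  obtain ⟨N, hNW, hN, hsN⟩ := mem_nhds_iff.1 hW
  -- All translates of `N` are removed, not only `N`, since `c` also takes the value `c s` at the
  -- translates of `s`.
  let K : Set ℝ := Icc (s - P) (s + P) \ ⋃ n : ℤ, (fun t => t + n * P) ⁻¹' N
  have hK : IsCompact K := isCompact_Icc.diff
    (isOpen_iUnion fun n => hN.preimage (continuous_add_const _))
  have hcl : IsClosed (c '' K) := (hK.image h.continuous_c).isClosed
  have hper := fun n t => h.periodic_c.int_mul n t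
  refine mem_nhdsWithin.2 ⟨(c '' K)ᶜ, hcl.isOpen_compl, ?_, ?_⟩
  · rintro ⟨t, ⟨-, ht⟩, hts⟩
    obtain ⟨n, hn⟩ := h.exists_int s t hts.symm
    exact ht (mem_iUnion.2 ⟨n, by rw [mem_preimage, ← hn]; exact hsN⟩)
  · rintro _ ⟨hx, ⟨t, rfl⟩⟩
    obtain ⟨m, hm, -⟩ := existsUnique_add_zsmul_mem_Ico h.pos t s
    rw [zsmul_eq_mul] at hm
    by_contra hW'
    refine hx ⟨t + m * P, ⟨⟨by linarith [hm.1, h.pos], hm.2.le⟩, ?_⟩, hper m t⟩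
    intro hu
    obtain ⟨n, hn⟩ := mem_iUnion.1 hu
    refine hW' ?_
    have := hNW hn
    rwa [mem_preimage, hper, hper] at this

end IsFramed

/-! ### Congruence of arcs with equal curvature. -/

section Congruence

theorem SE2_apply_eq (g : Plane ≃ᵃⁱ[ℝ] Plane) (x y : Plane) :
    g x = g.linearIsometryEquiv (x - y) + g y := by
  have e := g.map_vadd y (x -ᵥ y)
  rw [vsub_vadd] at e
  exact e

theorem hasDerivAt_linearIsometryEquiv (R : Plane ≃ₗᵢ[ℝ] Plane) {f : ℝ → Plane} {f' : Plane}
    {s : ℝ} (hf : HasDerivAt f f' s) : HasDerivAt (fun u => R (f u)) (R f') s :=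
  (R.toContinuousLinearEquiv : Plane →L[ℝ] Plane).hasFDerivAt.comp_hasDerivAt s hf

theorem hasDerivAt_affineIsometryEquiv (g : Plane ≃ᵃⁱ[ℝ] Plane) {f : ℝ → Plane} {f' : Plane}
    {s : ℝ} (hf : HasDerivAt f f' s) :
    HasDerivAt (fun u => g (f u)) (g.linearIsometryEquiv f') s := by
  have : (fun u => g (f u)) = fun u => g.linearIsometryEquiv (f u) + g 0 := by
    funext u
    rw [SE2_apply_eq g (f u) 0, sub_zero]
  rw [this]
  exact (hasDerivAt_linearIsometryEquiv _ hf).add_const _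

theorem eq_of_hasDerivAt_zero {E : Type*} [NormedAddCommGroup E] [NormedSpace ℝ E] {f : ℝ → E}
    {a b s t : ℝ} (hf : ∀ u ∈ Ioo a b, HasDerivAt f 0 u) (hs : s ∈ Ioo a b) (ht : t ∈ Ioo a b) :
    f s = f t :=
  isOpen_Ioo.is_const_of_deriv_eq_zero isPreconnected_Ioo
    (fun u hu => (hf u hu).differentiableAt.differentiableWithinAt)
    (fun u hu => (hf u hu).deriv) hs ht

namespace IsFramed

variable {c T : ℝ → Plane} {k kd : ℝ → ℝ} {P : ℝ}

theorem T_ne_zero (h : IsFramed c T k kd P) (s : ℝ) : T s ≠ 0 := by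
  intro h0
  have := h.norm_T s
  rw [h0, norm_zero] at this
  exact zero_ne_one this

/-- Arcs with the same curvature function are congruent. -/
theorem SE2_apply_of_curvature_eq (h : IsFramed c T k kd P) {g : Plane ≃ᵃⁱ[ℝ] Plane}
    (hg : g ∈ SE2) {a b s d : ℝ} (hk : ∀ t ∈ Ioo a b, k (t + d) = k t) (hs : s ∈ Ioo a b)
    (hc : g (c s) = c (s + d)) (hT : g.linearIsometryEquiv (T s) = T (s + d)) {t : ℝ}
    (ht : t ∈ Ioo a b) :
    g (c t) = c (t + d) ∧ g.linearIsometryEquiv (T t) = T (t + d) := by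
  have hTd : ∀ u ∈ Ioo a b, g.linearIsometryEquiv (T u) = T (u + d) := by
    intro u hu
    -- Both terms solve the linear Frenet equation with the same coefficient `k`, hence so does `D`.
    -- The quarter turn is skew, so the norm of `D` is constant, and `D` vanishes at `s`.
    let D : ℝ → Plane := fun r => T (r + d) - g.linearIsometryEquiv (T r)
    have hD : ∀ r ∈ Ioo a b, HasDerivAt D (k r • quarterTurn (D r)) r := by
      intro r hr
      have e1 := (h.deriv_T (r + d)).comp_add_const r d
      have e2 := hasDerivAt_linearIsometryEquiv g.linearIsometryEquiv (h.deriv_T r)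
      have e3 := e1.sub e2
      rw [hk r hr, map_smul, quarterTurn_comm hg, ← smul_sub, ← map_sub] at e3
      exact e3
    have hN : ∀ r ∈ Ioo a b, HasDerivAt (fun r => inner ℝ (D r) (D r)) (0 : ℝ) r := by
      intro r hr
      have e := (hD r hr).inner ℝ (hD r hr)
      have z := inner_quarterTurn_self (D r)
      rw [inner_smul_left, inner_smul_right, real_inner_comm, z] at e
      simpa using e
    have := eq_of_hasDerivAt_zero hN hu hs
    have hDs : D s = 0 := sub_eq_zero.2 hT.symm
    rw [hDs, inner_zero_left, inner_self_eq_zero] at this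
    exact (sub_eq_zero.1 this).symm
  refine ⟨?_, hTd t ht⟩
  have hC : ∀ r ∈ Ioo a b, HasDerivAt (fun r => c (r + d) - g (c r)) 0 r := by
    intro r hr
    have e1 := (h.deriv_c (r + d)).comp_add_const r d
    have e3 := e1.sub (hasDerivAt_affineIsometryEquiv g (h.deriv_c r))
    rw [hTd r hr, sub_self] at e3
    exact e3
  have := eq_of_hasDerivAt_zero hC ht hs
  simp only [hc, sub_self] at this
  exact (sub_eq_zero.1 this).symm

end IsFramed

end Congruence

/-! ### The curve in arc length: symmetries, edges and components. -/

/-- `c`, `T`, `k` and `kd` are an arc length parametrization, the tangent, the curvature and its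
derivative of the curve `Γ` given by `γ`. -/
structure Frames (γ c T : ℝ → Plane) (k kd : ℝ → ℝ) (P : ℝ) : Prop extends
    IsFramed c T k kd P where
  curve_eq : curve γ = range c
  signatureMap_c : ∀ s, signatureMap γ (c s) = sig k kd s
  tangent_c : ∀ s, tangent γ (c s) = T s

/-- The self-intersections of the path with coordinates `k` and `kd`. -/
abbrev crossings (k kd : ℝ → ℝ) : Set Plane := selfIntersections (range (sig k kd))

/-- The gaps that start in `[0, P)` and trace out `E`. -/
def gapsOver (k kd : ℝ → ℝ) (P : ℝ) (E : Set Plane) : Set (ℝ × ℝ) :=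
  {I | I.1 ∈ Ico 0 P ∧ IsGap (sig k kd) (crossings k kd) I.1 I.2 ∧ sig k kd '' Ioo I.1 I.2 = E}

namespace Frames

variable {γ c T : ℝ → Plane} {k kd : ℝ → ℝ} {P : ℝ}

theorem signature_eq (h : Frames γ c T k kd P) : signature γ = range (sig k kd) := by
  rw [signature, h.curve_eq, ← range_comp]
  exact congrArg range (funext h.signatureMap_c)

theorem quiverVertices_eq (h : Frames γ c T k kd P) : quiverVertices γ = crossings k kd := by
  rw [quiverVertices, h.signature_eq]

theorem mem_curve (h : Frames γ c T k kd P) (s : ℝ) : c s ∈ curve γ :=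
  h.curve_eq ▸ mem_range_self s

section Symmetry

/-- Lifting `g ∘ c` through `c` gives a reparametrization that respects unit tangents, hence a
translation. Differentiating `T (t + d) = g (T t)` shows that curvatures agree near `s`, and so do
their derivatives at `s`. -/
theorem signatureMap_eq_of_mem_localSymmetries (h : Frames γ c T k kd P) {s : ℝ}
    {g : Plane ≃ᵃⁱ[ℝ] Plane} (hg : g ∈ localSymmetries γ (c s)) :
    g (c s) ∈ signaturePreimage γ {signatureMap γ (c s)} := by
  obtain ⟨hSE, U, hU, hsU, hgU, hgT⟩ := hg
  have hmem : ∀ᶠ t in 𝓝 s, c t ∈ curve γ ∩ U := by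
    filter_upwards [h.continuous_c.continuousAt.preimage_mem_nhds (hU.mem_nhds hsU)] with t ht
    exact ⟨h.mem_curve t, ht⟩
  have hran : ∀ q ∈ curve γ ∩ U, g q ∈ curve γ := fun q hq =>
    (hgU ▸ mem_image_of_mem g hq : g q ∈ curve γ ∩ g '' U).1
  have hs := hran _ hmem.self_of_nhds
  refine ⟨hs, ?_⟩
  rw [h.curve_eq] at hs
  obtain ⟨s', hs'⟩ := hs
  have hP := h.pos
  have hcI := h.c_injOn (s' - P / 2)
  obtain ⟨φ, hφ0, hφ⟩ := exists_local_lift (f := c) (h := fun t => g (c t)) (x := s') (t₀ := s)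
    isOpen_Ioo ⟨by linarith, by linarith⟩ hcI (fun t _ => h.c_nhdsWithin_le t)
    (g.continuous.comp h.continuous_c)
    (hmem.mono fun t ht => h.curve_eq ▸ hran _ ht) hs'.symm
  have hTφ : ∀ᶠ t in 𝓝 s, T (φ t) = g.linearIsometryEquiv (T t) := by
    filter_upwards [hφ, hmem] with t ht ht'
    rw [← h.tangent_c, ht.2.1, ← h.tangent_c t, hgT _ ht']
  have hTcont : Continuous fun t => inner ℝ (T s') (g.linearIsometryEquiv (T t)) :=
    continuous_const.inner (g.linearIsometryEquiv.continuous.comp h.continuous_T)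
  have hTs : g.linearIsometryEquiv (T s) = T s' := by
    rw [← hTφ.self_of_nhds, hφ0]
  -- Projection to the tangent line at `c s'` reduces the comparison to real functions, with
  -- derivative nonzero nearby. Preservation of orientation gives `φ' = 1` rather than `-1`.
  have key := eventually_eq_translate (F := fun t => inner ℝ (T s') (c t))
    (F' := fun t => inner ℝ (T s') (T t)) (φ := φ) (t₀ := s)
    (H := fun t => inner ℝ (T s') (g (c t)))
    (H' := fun t => inner ℝ (T s') (g.linearIsometryEquiv (T t)))
    (fun t => by simpa using (hasDerivAt_const t (T s')).inner ℝ (h.deriv_c t))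
    (continuous_const.inner h.continuous_T)
    (fun t => by
      simpa using (hasDerivAt_const t (T s')).inner ℝ
        (hasDerivAt_affineIsometryEquiv g (h.deriv_c t)))
    (hφ.mono fun t ht => ht.2.2) (hφ.mono fun t ht => by simp only [ht.2.1])
    (by
      refine eventually_nhdsWithin_of_eventually_nhds ?_
      have : ∀ᶠ t in 𝓝 s, inner ℝ (T s') (g.linearIsometryEquiv (T t)) ≠ (0 : ℝ) := by
        refine hTcont.continuousAt.eventually_ne ?_
        rw [hTs, real_inner_self_eq_norm_sq, h.norm_T]
        norm_num
      filter_upwards [hTφ, this] with t ht ht'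
      exact ⟨by rw [ht], ht'⟩)
  have hTd : ∀ᶠ t in 𝓝 s, T (t + (s' - s)) = g.linearIsometryEquiv (T t) := by
    filter_upwards [hTφ, key] with t ht ht'
    rw [← ht, ht', hφ0]
    congr 1
    ring
  have hk : ∀ᶠ t in 𝓝 s, k (t + (s' - s)) = k t := by
    filter_upwards [hTd.eventually_nhds] with t ht
    have e1 := (h.deriv_T (t + (s' - s))).comp_add_const t (s' - s)
    have e2 := (hasDerivAt_linearIsometryEquiv g.linearIsometryEquiv
      (h.deriv_T t)).congr_of_eventuallyEq ht
    have e3 := e1.unique e2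
    rw [map_smul, quarterTurn_comm hSE, ← ht.self_of_nhds] at e3
    refine smul_left_injective ℝ (fun h0 => ?_) e3
    exact h.T_ne_zero _ (quarterTurn.map_eq_zero_iff.1 h0)
  have hkd : kd (s + (s' - s)) = kd s :=
    ((h.deriv_k _).comp_add_const s (s' - s)).unique ((h.deriv_k s).congr_of_eventuallyEq hk)
  have hks := hk.self_of_nhds
  rw [add_sub_cancel] at hkd hks
  rw [mem_singleton_iff, ← hs', h.signatureMap_c, h.signatureMap_c]
  exact sig_eq_iff.2 ⟨hks, hkd⟩

theorem exists_mem_localSymmetries (h : Frames γ c T k kd P) (hfin : (crossings k kd).Finite)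
    {s : ℝ} (hs : sig k kd s ∉ crossings k kd) {q : Plane}
    (hq : q ∈ signaturePreimage γ {signatureMap γ (c s)}) :
    ∃ g ∈ localSymmetries γ (c s), g (c s) = q := by
  obtain ⟨hqc, hqs⟩ := hq
  rw [h.curve_eq] at hqc
  obtain ⟨s', rfl⟩ := hqc
  rw [mem_singleton_iff, h.signatureMap_c, h.signatureMap_c] at hqs
  obtain ⟨g, hg, hgc, hgT⟩ := exists_SE2 (c s) (c s') ((h.norm_T s).trans (h.norm_T s').symm)
  refine ⟨g, ?_, hgc⟩
  have hsd : s + (s' - s) = s' := add_sub_cancel s s'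
  obtain ⟨a, b, hab, hsub⟩ := exists_Icc_subset_of_mem_nhds
    (h.eventually_sig_add hfin (t := s) (d := s' - s) hs (by rw [hsd, hqs]))
  have key := fun t ht => h.SE2_apply_of_curvature_eq (t := t) hg
    (fun t ht => (sig_eq_iff.1 (hsub (Ioo_subset_Icc_self ht))).1) hab
    (by rw [hsd, hgc]) (by rw [hsd, hgT]) ht
  -- Two conditions on the neighbourhood: the curve meets `O` only in the arc around `c s`, and
  -- meets `O'` only in the matching arc around `c s'`. The second keeps other branches out of `g ''
  -- U`.
  obtain ⟨O, hO, hsO, hOsub⟩ := mem_nhdsWithin.1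
    (h.c_nhdsWithin_le s (image_mem_map (Ioo_mem_nhds hab.1 hab.2)))
  obtain ⟨O', hO', hsO', hOsub'⟩ := mem_nhdsWithin.1
    (h.c_nhdsWithin_le s' (image_mem_map
      (Ioo_mem_nhds (show a + (s' - s) < s' by linarith [hab.1])
        (show s' < b + (s' - s) by linarith [hab.2]))))
  have hUmem : ∀ x ∈ curve γ ∩ (O ∩ g ⁻¹' O'), ∃ t ∈ Ioo a b, c t = x := fun x hx =>
    hOsub ⟨hx.2.1, h.curve_eq ▸ hx.1⟩
  refine ⟨hg, O ∩ g ⁻¹' O', hO.inter (hO'.preimage g.continuous),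
    ⟨hsO, by rwa [mem_preimage, hgc]⟩, ?_, ?_⟩
  · refine Subset.antisymm ?_ ?_
    · rintro _ ⟨x, hx, rfl⟩
      obtain ⟨t, ht, rfl⟩ := hUmem x hx
      exact ⟨(key t ht).1 ▸ h.mem_curve _, mem_image_of_mem g hx.2⟩
    · rintro _ ⟨hy, x, hx, rfl⟩
      obtain ⟨t, ht, hty⟩ := hOsub' ⟨hx.2, h.curve_eq ▸ hy⟩
      have hmem : t - (s' - s) ∈ Ioo a b := ⟨by linarith [ht.1], by linarith [ht.2]⟩
      have e := (key _ hmem).1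
      rw [sub_add_cancel, hty] at e
      have := g.injective e
      exact ⟨x, ⟨this ▸ h.mem_curve _, hx⟩, rfl⟩
  · intro x hx
    obtain ⟨t, ht, rfl⟩ := hUmem x hx
    rw [h.tangent_c, (key t ht).1, (key t ht).2, h.tangent_c]

/-- Evaluation at `c s` is a bijection from the local symmetries to the signature fibre; it is
injective because a local symmetry must also match the tangents. -/
theorem symIndexAt_eq (h : Frames γ c T k kd P) (hfin : (crossings k kd).Finite)
    {s : ℝ} (hs : sig k kd s ∉ crossings k kd) : symIndexAt γ (c s) = sigIndexAt γ (c s) := by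
  have hinj : InjOn (fun g : Plane ≃ᵃⁱ[ℝ] Plane => g (c s)) (localSymmetries γ (c s)) := by
    rintro g ⟨hg, U, hU, hsU, -, hgT⟩ g' ⟨hg', U', hU', hsU', -, hgT'⟩ hgg'
    refine SE2_ext hg hg' (h.T_ne_zero s) hgg' ?_
    rw [← h.tangent_c, hgT _ ⟨h.mem_curve s, hsU⟩, hgT' _ ⟨h.mem_curve s, hsU'⟩]
    exact congrArg (tangent γ) hgg'
  rw [symIndexAt, sigIndexAt, ← hinj.encard_image]
  congr 1
  refine Subset.antisymm ?_ fun q hq => h.exists_mem_localSymmetries hfin hs hq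
  rintro _ ⟨g, hg, rfl⟩
  exact h.signatureMap_eq_of_mem_localSymmetries hg

end Symmetry

section Components

theorem mem_of_image_eq (h : Frames γ c T k kd P) (hfin : (crossings k kd).Finite)
    {a b a' b' s : ℝ} (hg : IsGap (sig k kd) (crossings k kd) a b)
    (hg' : IsGap (sig k kd) (crossings k kd) a' b') (hs : s ∈ Ioo a b)
    (hE : sig k kd s ∈ sig k kd '' Ioo a' b') :
    b' - b = a' - a ∧ ∀ t ∈ Icc a b, sig k kd (t + (a' - a)) = sig k kd t := by
  obtain ⟨s', hs', hss'⟩ := hE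
  obtain ⟨h1, h2, h3⟩ := h.gap_translate hfin hg hg' hs hs' hss'.symm
  exact ⟨by rw [h1, h2], by rwa [h1]⟩

theorem image_eq_of_image_inter (h : Frames γ c T k kd P) (hfin : (crossings k kd).Finite)
    {a b a' b' : ℝ} (hg : IsGap (sig k kd) (crossings k kd) a b)
    (hg' : IsGap (sig k kd) (crossings k kd) a' b')
    (hE : (sig k kd '' Ioo a b ∩ sig k kd '' Ioo a' b').Nonempty) :
    sig k kd '' Ioo a b = sig k kd '' Ioo a' b' := by
  obtain ⟨_, ⟨s, hs, rfl⟩, hs'⟩ := hE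
  obtain ⟨h1, h2⟩ := h.mem_of_image_eq hfin hg hg' hs hs'
  refine Subset.antisymm ?_ ?_
  · rintro _ ⟨t, ht, rfl⟩
    exact ⟨t + (a' - a), ⟨by linarith [ht.1], by linarith [ht.2]⟩, h2 t (Ioo_subset_Icc_self ht)⟩
  · rintro _ ⟨t, ht, rfl⟩
    have hm : t - (a' - a) ∈ Ioo a b := ⟨by linarith [ht.1], by linarith [ht.2]⟩
    refine ⟨_, hm, ?_⟩
    rw [← h2 _ (Ioo_subset_Icc_self hm), sub_add_cancel]

theorem exists_gapsOver (h : Frames γ c T k kd P) {a b : ℝ}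
    (hg : IsGap (sig k kd) (crossings k kd) a b) :
    ∃ n : ℤ, (a + n * P, b + n * P) ∈ gapsOver k kd P (sig k kd '' Ioo a b) := by
  obtain ⟨n, hn⟩ := h.exists_int_mem_Ico a
  refine ⟨n, hn, hg.add_int_mul h.periodic_sig n, ?_⟩
  have : Ioo (a + n * P) (b + n * P) = (fun t => t + n * P) '' Ioo a b := by simp
  rw [this, image_image]
  exact image_congr fun t _ => h.periodic_sig.int_mul n t

/-- The images of the gaps cover the signature off the crossings, are connected and relatively open,
and coincide as soon as they meet. -/
theorem quiverEdges_eq (h : Frames γ c T k kd P) (hfin : (crossings k kd).Finite)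
    (hne : (crossings k kd).Nonempty) :
    quiverEdges γ = {E | (gapsOver k kd P E).Nonempty} := by
  have hne' : ∃ a, sig k kd a ∈ crossings k kd := by
    obtain ⟨q, hq⟩ := hne
    obtain ⟨a, rfl⟩ := hq.1
    exact ⟨a, hq⟩
  rw [quiverEdges, h.quiverVertices_eq, h.signature_eq, components]
  refine image_connectedComponentIn_eq_of_cover ?_ ?_ ?_ ?_ ?_
  · refine Subset.antisymm ?_ ?_
    · rintro q ⟨E, ⟨I, -, hI, rfl⟩, t, ht, rfl⟩
      exact ⟨mem_range_self t, hI.2.2.2 t ht⟩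
    · rintro q ⟨⟨t, rfl⟩, hq⟩
      obtain ⟨a, b, hg, ht⟩ := h.exists_gap_of_notMem hfin hne' hq
      obtain ⟨n, hn⟩ := h.exists_gapsOver hg
      exact ⟨_, ⟨_, hn⟩, mem_image_of_mem _ ht⟩
  · rintro E ⟨I, -, hI, rfl⟩
    exact (nonempty_Ioo.2 hI.1).image _
  · rintro E ⟨I, -, hI, rfl⟩
    exact isPreconnected_Ioo.image _ h.continuous_sig.continuousOn
  · rintro E ⟨I, -, hI, rfl⟩ _ ⟨t, ht, rfl⟩
    exact nhdsWithin_mono _ sdiff_subset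
      (h.sig_nhdsWithin_le (hI.2.2.2 t ht) (image_mem_map (Ioo_mem_nhds ht.1 ht.2)))
  · rintro E ⟨I, -, hI, rfl⟩ E' ⟨I', -, hI', rfl⟩ hEE'
    exact h.image_eq_of_image_inter hfin hI hI' hEE'

theorem finite_gapsOver_union (h : Frames γ c T k kd P) (hfin : (crossings k kd).Finite) :
    {I : ℝ × ℝ | I.1 ∈ Ico 0 P ∧ IsGap (sig k kd) (crossings k kd) I.1 I.2}.Finite := by
  refine Set.Finite.of_finite_image (f := Prod.fst) ((h.finite_times hfin 0 P).subset ?_) ?_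
  · rintro _ ⟨I, ⟨hI, hI'⟩, rfl⟩
    exact ⟨Ico_subset_Icc_self hI, hI'.2.1⟩
  · rintro ⟨a, b⟩ ⟨-, hI⟩ ⟨a', b'⟩ ⟨-, hI'⟩ rfl
    exact Prod.ext rfl (hI.right_unique hI')

theorem finite_gapsOver (h : Frames γ c T k kd P) (hfin : (crossings k kd).Finite)
    (E : Set Plane) : (gapsOver k kd P E).Finite :=
  (h.finite_gapsOver_union hfin).subset fun _ hI => ⟨hI.1, hI.2.1⟩

theorem finite_quiverEdges (h : Frames γ c T k kd P) (hfin : (crossings k kd).Finite)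
    (hne : (crossings k kd).Nonempty) : (quiverEdges γ).Finite := by
  rw [h.quiverEdges_eq hfin hne]
  refine ((h.finite_gapsOver_union hfin).image fun I => sig k kd '' Ioo I.1 I.2).subset ?_
  rintro E ⟨I, h1, h2, rfl⟩
  exact ⟨I, ⟨h1, h2⟩, rfl⟩

/-- Gaps in one period that contain, at the same distance from their starts, the same point of the
curve agree. -/
theorem gap_eq_of_c_eq (h : Frames γ c T k kd P) {E : Set Plane} {I I' : ℝ × ℝ} {d : ℝ}
    (hI : I ∈ gapsOver k kd P E) (hI' : I' ∈ gapsOver k kd P E)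
    (hc : c (I.1 + d) = c (I'.1 + d)) : I = I' := by
  obtain ⟨n, hn⟩ := h.exists_int _ _ hc
  have h0 := h.int_eq_zero hI.1 hI'.1 (n := n) (by linarith)
  rw [h0, Int.cast_zero, zero_mul, add_zero] at hn
  have h1 : I.1 = I'.1 := by linarith
  exact Prod.ext h1 (hI.2.1.right_unique (h1 ▸ hI'.2.1))

/-- A common point of the arcs has one signature, so it lies at the same distance from the start of
each gap; simplicity of the curve then identifies the gaps. -/
theorem gapsOver_eq_of_image_c_inter (h : Frames γ c T k kd P) (hfin : (crossings k kd).Finite)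
    {E : Set Plane} {I I' : ℝ × ℝ}
    (hI : I ∈ gapsOver k kd P E) (hI' : I' ∈ gapsOver k kd P E)
    (hne : (c '' Ioo I.1 I.2 ∩ c '' Ioo I'.1 I'.2).Nonempty) : I = I' := by
  obtain ⟨_, ⟨s, hs, rfl⟩, s', hs', hss'⟩ := hne
  have hσ : sig k kd s = sig k kd s' := by
    rw [← h.signatureMap_c, ← h.signatureMap_c, hss']
  obtain ⟨h1, -, -⟩ := h.gap_translate hfin hI.2.1 hI'.2.1 hs hs' hσ
  refine h.gap_eq_of_c_eq hI hI' (d := s - I.1) ?_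
  rw [add_sub_cancel, ← hss']
  congr 1
  linarith

theorem components_signaturePreimage (h : Frames γ c T k kd P) (hfin : (crossings k kd).Finite)
    {E : Set Plane} (hE : (gapsOver k kd P E).Nonempty) :
    components (signaturePreimage γ E) = (fun I => c '' Ioo I.1 I.2) '' gapsOver k kd P E := by
  have hEQ : ∀ q ∈ E, q ∉ crossings k kd := by
    obtain ⟨I, -, hI, rfl⟩ := hE
    rintro _ ⟨t, ht, rfl⟩
    exact hI.2.2.2 t ht
  have hne' : ∃ a, sig k kd a ∈ crossings k kd := by
    obtain ⟨I, -, hI, -⟩ := hE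
    exact ⟨_, hI.2.1⟩
  refine image_connectedComponentIn_eq_of_cover ?_ ?_ ?_ ?_ ?_
  · refine Subset.antisymm ?_ ?_
    · rintro q ⟨_, ⟨I, ⟨-, -, rfl⟩, rfl⟩, t, ht, rfl⟩
      exact ⟨h.mem_curve t, by rw [h.signatureMap_c]; exact mem_image_of_mem _ ht⟩
    · rintro q ⟨hq, hqE⟩
      rw [h.curve_eq] at hq
      obtain ⟨t, rfl⟩ := hq
      rw [h.signatureMap_c] at hqE
      obtain ⟨a, b, hg, ht⟩ := h.exists_gap_of_notMem hfin hne' (hEQ _ hqE)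
      have hEE : sig k kd '' Ioo a b = E := by
        obtain ⟨I, -, hI, rfl⟩ := hE
        exact h.image_eq_of_image_inter hfin hg hI ⟨_, mem_image_of_mem _ ht, hqE⟩
      obtain ⟨n, hn⟩ := h.exists_gapsOver hg
      rw [hEE] at hn
      refine ⟨_, ⟨_, hn, rfl⟩, t + n * P, ⟨by simpa using ht.1, by simpa using ht.2⟩, ?_⟩
      exact h.periodic_c.int_mul n t
  · rintro _ ⟨I, hI, rfl⟩
    exact (nonempty_Ioo.2 hI.2.1.1).image _
  · rintro _ ⟨I, hI, rfl⟩
    exact isPreconnected_Ioo.image _ h.continuous_c.continuousOn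
  · rintro _ ⟨I, hI, rfl⟩ _ ⟨t, ht, rfl⟩
    exact nhdsWithin_mono _ (fun q hq => h.curve_eq ▸ hq.1)
      (h.c_nhdsWithin_le t (image_mem_map (Ioo_mem_nhds ht.1 ht.2)))
  · rintro _ ⟨I, hI, rfl⟩ _ ⟨I', hI', rfl⟩ hne
    rw [h.gapsOver_eq_of_image_c_inter hfin hI hI' hne]

theorem encard_components (h : Frames γ c T k kd P) (hfin : (crossings k kd).Finite)
    {E : Set Plane} (hE : (gapsOver k kd P E).Nonempty) :
    (components (signaturePreimage γ E)).encard = (gapsOver k kd P E).encard := by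
  rw [h.components_signaturePreimage hfin hE]
  refine InjOn.encard_image fun I hI I' hI' hII' => ?_
  refine h.gapsOver_eq_of_image_c_inter hfin hI hI' ?_
  rw [← hII', inter_self]
  exact (nonempty_Ioo.2 hI.2.1.1).image _

theorem congruent_of_mem_gapsOver (h : Frames γ c T k kd P) (hfin : (crossings k kd).Finite)
    {E : Set Plane} {I I' : ℝ × ℝ}
    (hI : I ∈ gapsOver k kd P E) (hI' : I' ∈ gapsOver k kd P E) :
    Congruent γ (c '' Ioo I.1 I.2) (c '' Ioo I'.1 I'.2) := by
  obtain ⟨a, b⟩ := I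
  obtain ⟨a', b'⟩ := I'
  obtain ⟨-, hg, rfl⟩ := hI
  obtain ⟨-, hg', hE⟩ := hI'
  simp only at hg hg' hE ⊢
  obtain ⟨s, hs⟩ := nonempty_Ioo.2 hg.1
  obtain ⟨h1, h2⟩ := h.mem_of_image_eq hfin hg hg' hs (hE ▸ mem_image_of_mem _ hs)
  obtain ⟨g, hSE, hgc, hgT⟩ := exists_SE2 (c s) (c (s + (a' - a)))
    ((h.norm_T s).trans (h.norm_T _).symm)
  have key := fun t ht => h.SE2_apply_of_curvature_eq (t := t) hSE
    (fun t ht => (sig_eq_iff.1 (h2 t (Ioo_subset_Icc_self ht))).1) hs hgc hgT ht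
  refine ⟨g, hSE, Subset.antisymm ?_ ?_, ?_⟩
  · rintro _ ⟨_, ⟨t, ht, rfl⟩, rfl⟩
    exact ⟨t + (a' - a), ⟨by linarith [ht.1], by linarith [ht.2]⟩, (key t ht).1.symm⟩
  · rintro _ ⟨t, ht, rfl⟩
    have hm : t - (a' - a) ∈ Ioo a b := ⟨by linarith [ht.1], by linarith [ht.2]⟩
    refine ⟨_, mem_image_of_mem _ hm, ?_⟩
    rw [(key _ hm).1, sub_add_cancel]
  · rintro _ ⟨t, ht, rfl⟩
    rw [h.tangent_c, (key t ht).1, (key t ht).2, h.tangent_c]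

/-- The closed interval admits endpoints, so that points over crossings also receive a lower bound
for their index. -/
theorem mapsTo_signaturePreimage (h : Frames γ c T k kd P) (hfin : (crossings k kd).Finite)
    {a b s : ℝ} (hg : IsGap (sig k kd) (crossings k kd) a b) (hs : s ∈ Icc a b) :
    MapsTo (fun I : ℝ × ℝ => c (I.1 + (s - a))) (gapsOver k kd P (sig k kd '' Ioo a b))
      (signaturePreimage γ {signatureMap γ (c s)}) := by
  rintro ⟨a', b'⟩ ⟨-, hg', hE⟩
  obtain ⟨r, hr⟩ := nonempty_Ioo.2 hg.1
  obtain ⟨-, h2⟩ := h.mem_of_image_eq hfin hg hg' hr (hE ▸ mem_image_of_mem _ hr)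
  refine ⟨h.mem_curve _, ?_⟩
  rw [mem_singleton_iff, h.signatureMap_c, h.signatureMap_c, ← h2 s hs]
  simp only
  congr 1
  ring

theorem le_sigIndexAt (h : Frames γ c T k kd P) (hfin : (crossings k kd).Finite)
    {a b s : ℝ} (hg : IsGap (sig k kd) (crossings k kd) a b) (hs : s ∈ Icc a b) :
    (gapsOver k kd P (sig k kd '' Ioo a b)).encard ≤ sigIndexAt γ (c s) :=
  encard_le_encard_of_injOn (h.mapsTo_signaturePreimage hfin hg hs)
    fun _ hI _ hI' hc => h.gap_eq_of_c_eq hI hI' hc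

/-- In the interior of a gap every other point of the fibre also lies in a gap, necessarily a
translate over the same edge, so the lower bound is exact. -/
theorem sigIndexAt_eq (h : Frames γ c T k kd P) (hfin : (crossings k kd).Finite)
    {a b s : ℝ} (hg : IsGap (sig k kd) (crossings k kd) a b) (hs : s ∈ Ioo a b) :
    sigIndexAt γ (c s) = (gapsOver k kd P (sig k kd '' Ioo a b)).encard := by
  refine le_antisymm ?_ (h.le_sigIndexAt hfin hg (Ioo_subset_Icc_self hs))
  refine (encard_le_encard ?_).trans
    (encard_image_le (fun I : ℝ × ℝ => c (I.1 + (s - a))) _)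
  rintro q ⟨hq, hqs⟩
  rw [h.curve_eq] at hq
  obtain ⟨s', rfl⟩ := hq
  rw [mem_singleton_iff, h.signatureMap_c, h.signatureMap_c] at hqs
  obtain ⟨a', b', hg', hs'⟩ := h.exists_gap_of_notMem hfin ⟨a, hg.2.1⟩ (t := s')
    (hqs ▸ hg.2.2.2 s hs)
  obtain ⟨h1, h2, -⟩ := h.gap_translate hfin hg hg' hs hs' hqs.symm
  obtain ⟨n, hn⟩ := h.exists_gapsOver hg'
  rw [← h.image_eq_of_image_inter hfin hg hg'
    ⟨_, mem_image_of_mem _ hs, hqs ▸ mem_image_of_mem _ hs'⟩] at hn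
  refine ⟨_, hn, ?_⟩
  rw [← h.periodic_c.int_mul n s']
  simp only
  congr 1
  linarith

/-- Every point lies on a closed gap, so its index is at least some multiplicity; interior points of
gaps realize each multiplicity. -/
theorem isLeast_sigIndex (h : Frames γ c T k kd P) (hfin : (crossings k kd).Finite)
    (hne : (crossings k kd).Nonempty) :
    IsLeast {m | ∃ E ∈ quiverEdges γ, m = (gapsOver k kd P E).encard} (sigIndex γ) := by
  obtain ⟨q, hq⟩ := hne
  have hne' : ∃ a, sig k kd a ∈ crossings k kd := by
    obtain ⟨a, rfl⟩ := hq.1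
    exact ⟨a, hq⟩
  have hlow : ∀ s, ∃ E ∈ quiverEdges γ, (gapsOver k kd P E).encard ≤ sigIndexAt γ (c s) := by
    intro s
    obtain ⟨a, b, hg, hs⟩ : ∃ a b, IsGap (sig k kd) (crossings k kd) a b ∧ s ∈ Icc a b := by
      by_cases hs : sig k kd s ∈ crossings k kd
      · obtain ⟨b, hb⟩ := h.exists_gap_of_mem hfin hs
        exact ⟨s, b, hb, left_mem_Icc.2 hb.1.le⟩
      · obtain ⟨a, b, hg, hs⟩ := h.exists_gap_of_notMem hfin hne' hs
        exact ⟨a, b, hg, Ioo_subset_Icc_self hs⟩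
    refine ⟨_, ?_, h.le_sigIndexAt hfin hg hs⟩
    rw [h.quiverEdges_eq hfin ⟨q, hq⟩]
    obtain ⟨n, hn⟩ := h.exists_gapsOver hg
    exact ⟨_, hn⟩
  have hle : ∀ E ∈ quiverEdges γ, sigIndex γ ≤ (gapsOver k kd P E).encard := by
    intro E hE
    rw [h.quiverEdges_eq hfin ⟨q, hq⟩] at hE
    obtain ⟨I, -, hI, rfl⟩ := hE
    obtain ⟨s, hs⟩ := nonempty_Ioo.2 hI.1
    rw [← h.sigIndexAt_eq hfin hI hs]
    exact iInf₂_le (c s) (h.mem_curve s)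
  refine ⟨?_, by rintro m ⟨E, hE, rfl⟩; exact hle E hE⟩
  obtain ⟨p, hp, hmin⟩ : ∃ p ∈ curve γ, sigIndex γ = sigIndexAt γ p := by
    have : Nonempty (curve γ) := ⟨⟨c 0, h.mem_curve 0⟩⟩
    obtain ⟨p, hp⟩ := ciInf_mem fun p : curve γ => sigIndexAt γ p
    exact ⟨p, p.2, by rw [sigIndex, iInf_subtype', ← hp]⟩
  rw [h.curve_eq] at hp
  obtain ⟨s, rfl⟩ := hp
  obtain ⟨E, hE, hEs⟩ := hlow s
  exact ⟨E, hE, le_antisymm (hle E hE) (hmin ▸ hEs)⟩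

theorem isOpenSegment_sig (h : Frames γ c T k kd P) (hfin : (crossings k kd).Finite)
    {a b : ℝ} (hg : IsGap (sig k kd) (crossings k kd) a b) :
    Nonempty (↥(sig k kd '' Ioo a b) ≃ₜ ↥(Ioo a b)) :=
  nonempty_homeomorph_image_Ioo h.continuous_sig (h.gap_injOn hfin hg)
    fun s hs => h.sig_nhdsWithin_le (hg.2.2.2 s hs)

theorem isOpenSegment_c (h : Frames γ c T k kd P)
    {a b : ℝ} (hg : IsGap (sig k kd) (crossings k kd) a b) :
    Nonempty (↥(c '' Ioo a b) ≃ₜ ↥(Ioo a b)) :=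
  nonempty_homeomorph_image_Ioo h.continuous_c
    ((h.c_injOn a).mono (Ioo_subset_Ioo_right (h.gap_le hg))) fun s _ => h.c_nhdsWithin_le s

end Components

end Frames

/-! ### Arc length parametrization and transfer back to `γ`. -/

section ArcLength

theorem quarterTurn_apply_zero (u : Plane) : quarterTurn u 0 = -u 1 := by
  have := inner_quarterTurn_left u (EuclideanSpace.single 0 1)
  simpa [det2, EuclideanSpace.inner_single_right] using this

theorem quarterTurn_apply_one (u : Plane) : quarterTurn u 1 = u 0 := by
  have := inner_quarterTurn_left u (EuclideanSpace.single 1 1)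
  simpa [det2, EuclideanSpace.inner_single_right] using this

theorem eq_det2_smul_quarterTurn {u w : Plane} (hu : ‖u‖ = 1) (huw : inner ℝ u w = 0) :
    w = det2 u w • quarterTurn u := by
  have h1 : u 0 ^ 2 + u 1 ^ 2 = 1 := by
    have := EuclideanSpace.real_norm_sq_eq u
    rw [hu, Fin.sum_univ_two] at this
    linarith
  have h2 : u 0 * w 0 + u 1 * w 1 = 0 := by
    simp only [PiLp.inner_apply, Fin.sum_univ_two, RCLike.inner_apply, conj_trivial] at huw
    linarith
  ext i
  fin_cases i
  · simp only [Fin.zero_eta, PiLp.smul_apply, quarterTurn_apply_zero, smul_eq_mul, det2]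
    linear_combination (-w 0) * h1 + u 0 * h2
  · simp only [Fin.mk_one, PiLp.smul_apply, quarterTurn_apply_one, smul_eq_mul, det2]
    linear_combination (-w 1) * h1 + u 1 * h2

namespace IsSimpleClosed

variable {γ : ℝ → Plane} {L : ℝ}

theorem speed_pos (h : IsSimpleClosed γ L) (t : ℝ) : 0 < ‖deriv γ t‖ :=
  norm_pos_iff.2 (h.regular t)

theorem contDiff_deriv (h : IsSimpleClosed γ L) : ContDiff ℝ 2 (deriv γ) :=
  ContDiff.iterate_deriv' 2 1 h.contDiff

theorem contDiff_deriv_deriv (h : IsSimpleClosed γ L) : ContDiff ℝ 1 (deriv (deriv γ)) :=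
  ContDiff.iterate_deriv' 1 1 h.contDiff_deriv

theorem contDiff_speed (h : IsSimpleClosed γ L) : ContDiff ℝ 2 fun t => ‖deriv γ t‖ :=
  h.contDiff_deriv.norm ℝ h.regular

theorem contDiff_curvature (h : IsSimpleClosed γ L) : ContDiff ℝ 1 (curvature γ) := by
  have h1 : ContDiff ℝ 1 (deriv γ) := h.contDiff_deriv.of_le (by norm_num)
  have h2 := h.contDiff_deriv_deriv
  have h3 : ContDiff ℝ 1 fun t => ‖deriv γ t‖ := h.contDiff_speed.of_le (by norm_num)
  rw [contDiff_euclidean] at h1 h2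
  refine ContDiff.div ?_ (h3.pow 3) fun t => pow_ne_zero _ (h.speed_pos t).ne'
  exact ((h1 0).mul (h2 1)).sub ((h1 1).mul (h2 0))

theorem hasDerivAt_curvature (h : IsSimpleClosed γ L) (t : ℝ) :
    HasDerivAt (curvature γ) (deriv (curvature γ) t) t :=
  (h.contDiff_curvature.differentiable (by norm_num)).differentiableAt.hasDerivAt

theorem continuous_curvatureDot (h : IsSimpleClosed γ L) : Continuous (curvatureDot γ) :=
  (h.contDiff_curvature.continuous_deriv le_rfl).div h.contDiff_speed.continuous
    fun t => (h.speed_pos t).ne'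

theorem norm_paramTangent (h : IsSimpleClosed γ L) (t : ℝ) : ‖paramTangent γ t‖ = 1 := by
  rw [paramTangent, norm_smul, norm_inv, norm_norm, inv_mul_cancel₀ (h.speed_pos t).ne']

/-- The derivative of a unit field is orthogonal to it, so only its determinant with the tangent is
needed. The derivative `m` of the inverse speed multiplies `deriv γ t` and drops out. -/
theorem hasDerivAt_paramTangent (h : IsSimpleClosed γ L) (t : ℝ) :
    HasDerivAt (paramTangent γ)
      ((‖deriv γ t‖ * curvature γ t) • quarterTurn (paramTangent γ t)) t := by
  have hv := h.speed_pos t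
  have h1 : HasDerivAt (deriv γ) (deriv (deriv γ) t) t :=
    (h.contDiff_deriv.differentiable (by norm_num)).differentiableAt.hasDerivAt
  have h2 : HasDerivAt (fun t => ‖deriv γ t‖⁻¹) (deriv (fun t => ‖deriv γ t‖⁻¹) t) t :=
    ((h.contDiff_speed.differentiable (by norm_num)).differentiableAt.inv hv.ne').hasDerivAt
  have h3 := h2.smul h1
  set m := deriv (fun t => ‖deriv γ t‖⁻¹) t
  set w := ‖deriv γ t‖⁻¹ • deriv (deriv γ) t + m • deriv γ t with hw
  have h4 : HasDerivAt (paramTangent γ) w t := h3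
  have h5 : inner ℝ (paramTangent γ t) w = 0 := by
    have e1 := h4.inner ℝ h4
    have e2 : (fun t => inner ℝ (paramTangent γ t) (paramTangent γ t)) = fun _ => (1 : ℝ) := by
      funext r
      rw [real_inner_self_eq_norm_sq, h.norm_paramTangent, one_pow]
    rw [e2] at e1
    have e3 := e1.unique (hasDerivAt_const t 1)
    rw [real_inner_comm w] at e3
    linarith [real_inner_comm w (paramTangent γ t)]
  have h6 := eq_det2_smul_quarterTurn (h.norm_paramTangent t) h5
  have h7 : det2 (paramTangent γ t) w = ‖deriv γ t‖ * curvature γ t := by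
    simp only [hw, paramTangent, det2, curvature, PiLp.smul_apply, PiLp.add_apply, smul_eq_mul]
    field_simp
    ring
  rw [h7] at h6
  rwa [← h6]

/-- The arc length of `γ` is an order isomorphism of the line. -/
theorem exists_arcLength (h : IsSimpleClosed γ L) :
    ∃ (e : ℝ ≃o ℝ) (P : ℝ), 0 < P ∧ e 0 = 0 ∧ (∀ t, HasDerivAt e ‖deriv γ t‖ t) ∧
      ∀ t, e (t + L) = e t + P := by
  have hc : Continuous fun t => ‖deriv γ t‖ := h.contDiff_speed.continuous
  have hper : Function.Periodic (fun t => ‖deriv γ t‖) L := fun t => by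
    simp only [periodic_deriv h.periodic t]
  let f : ℝ → ℝ := fun t => ∫ r in (0 : ℝ)..t, ‖deriv γ r‖
  have hf : ∀ t, HasDerivAt f ‖deriv γ t‖ t := fun t =>
    intervalIntegral.integral_hasDerivAt_right (hc.intervalIntegrable _ _)
      (hc.stronglyMeasurableAtFilter _ _) hc.continuousAt
  have hmono : StrictMono f := strictMono_of_deriv_pos fun t => by
    rw [(hf t).deriv]; exact h.speed_pos t
  have hcf : Continuous f := continuous_iff_continuousAt.2 fun t => (hf t).continuousAt
  have hsurj : Function.Surjective f := by
    exact hcf.surjective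
      (hper.tendsto_atTop_intervalIntegral_of_pos' (hc.intervalIntegrable _ _)
        h.speed_pos h.pos)
      (hper.tendsto_atBot_intervalIntegral_of_pos' (hc.intervalIntegrable _ _)
        h.speed_pos h.pos)
  have hf0 : f 0 = 0 := intervalIntegral.integral_same
  refine ⟨hmono.orderIsoOfSurjective f hsurj, f L, ?_, hf0, hf, fun t => ?_⟩
  · rw [← hf0]; exact hmono h.pos
  · change f (t + L) = f t + f L
    have e := hper.intervalIntegral_add_eq t 0
    rw [zero_add] at e
    change _ = _ + ∫ r in (0 : ℝ)..L, ‖deriv γ r‖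
    rw [← e, intervalIntegral.integral_add_adjacent_intervals] <;>
      exact hc.intervalIntegrable _ _

theorem arcLength_int_mul {e : ℝ → ℝ} {P : ℝ} (hL : L ≠ 0) (he : ∀ t, e (t + L) = e t + P)
    (n : ℤ) (t : ℝ) : e (t + n * L) = e t + n * P := by
  -- Subtracting the mean growth makes `e` periodic.
  have hp : Function.Periodic (fun t => e t - t * (P / L)) L := fun t => by
    simp only [he]
    field_simp
    ring
  have := hp.int_mul n t
  field_simp at this
  apply mul_left_cancel₀ hL
  linear_combination this

theorem eventually_curvatureDot_ne_zero (h : IsSimpleClosed γ L) (hnd : IsNondegenerate γ)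
    (t : ℝ) : ∀ᶠ r in 𝓝[≠] t, curvatureDot γ r ≠ 0 := by
  by_cases h0 : curvatureDot γ t = 0
  · have hv : ∀ r, γ r ∈ vertices γ ↔ curvatureDot γ r = 0 := fun r => by
      rw [vertices, mem_ofPred_eq, h.signatureMap_apply]
      exact and_iff_right (mem_range_self r)
    obtain ⟨U, hU, hUt⟩ := hnd (γ t) ((hv t).2 h0)
    have htU : γ t ∈ U := (hUt ▸ mem_singleton (γ t) : γ t ∈ U ∩ vertices γ).1
    rw [eventually_nhdsWithin_iff]
    filter_upwards [h.contDiff.continuous.continuousAt.preimage_mem_nhds (hU.mem_nhds htU),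
      Ioo_mem_nhds (show t - L < t by linarith [h.pos]) (show t < t + L by linarith [h.pos])]
      with r hrU hr hrt hr0
    have : γ r = γ t := by
      have : γ r ∈ U ∩ vertices γ := ⟨hrU, (hv r).2 hr0⟩
      rwa [hUt] at this
    obtain ⟨n, hn⟩ := h.exists_int this
    have hL := h.pos
    have h1 : (n : ℝ) < 1 := by
      by_contra! hn'
      nlinarith [hr.2]
    have h2 : (-1 : ℝ) < n := by
      by_contra! hn'
      nlinarith [hr.1]
    have h1' : n < 1 := by exact_mod_cast h1
    have h2' : -1 < n := by exact_mod_cast h2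
    have : n = 0 := by omega
    exact hrt (by simpa [this] using hn)
  · exact eventually_nhdsWithin_of_eventually_nhds
      (h.continuous_curvatureDot.continuousAt.eventually_ne h0)

theorem frames (h : IsSimpleClosed γ L) (hnd : IsNondegenerate γ) {e : ℝ ≃o ℝ} {P : ℝ}
    (hP : 0 < P) (hd : ∀ t, HasDerivAt e ‖deriv γ t‖ t) (he : ∀ t, e (t + L) = e t + P) :
    Frames γ (γ ∘ e.symm) (paramTangent γ ∘ e.symm) (curvature γ ∘ e.symm)
      (curvatureDot γ ∘ e.symm) P := by
  have hper : ∀ s, e.symm (s + P) = e.symm s + L := fun s => by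
    rw [OrderIso.symm_apply_eq, he, OrderIso.apply_symm_apply]
  have hd' : ∀ s, HasDerivAt e.symm ‖deriv γ (e.symm s)‖⁻¹ s := fun s =>
    HasDerivAt.of_local_left_inverse e.symm.continuous.continuousAt (hd _) (h.speed_pos _).ne'
      (Eventually.of_forall e.apply_symm_apply)
  have hcomp : ∀ {E : Type} (f : ℝ → E), Function.Periodic f L →
      Function.Periodic (f ∘ e.symm) P := fun f hf s => by
    simp only [Function.comp, hper, hf (e.symm s)]
  have hdot : Function.Periodic (curvatureDot γ) L := fun t => by
    simp only [curvatureDot, periodic_deriv (periodic_curvature h.periodic) t,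
      periodic_deriv h.periodic t]
  refine
    { pos := hP
      periodic_c := hcomp _ h.periodic
      periodic_T := hcomp _ (periodic_paramTangent h.periodic)
      periodic_k := hcomp _ (periodic_curvature h.periodic)
      periodic_kd := hcomp _ hdot
      exists_int := fun s t hst => ?_
      norm_T := fun s => h.norm_paramTangent _
      deriv_c := fun s => ?_
      deriv_T := fun s => ?_
      deriv_k := fun s => ?_
      continuous_kd := h.continuous_curvatureDot.comp e.symm.continuous
      isolated := fun s => ?_
      curve_eq := ?_
      signatureMap_c := fun s => h.signatureMap_apply _
      tangent_c := fun s => h.tangent_apply _ }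
  · obtain ⟨n, hn⟩ := h.exists_int hst
    refine ⟨n, ?_⟩
    have := congrArg e hn
    rwa [arcLength_int_mul h.pos.ne' he, e.apply_symm_apply, e.apply_symm_apply] at this
  · exact (h.contDiff.differentiable (by norm_num)).differentiableAt.hasDerivAt.scomp s (hd' s)
  · have := (h.hasDerivAt_paramTangent (e.symm s)).scomp s (hd' s)
    rwa [smul_smul, inv_mul_cancel_left₀ (h.speed_pos _).ne'] at this
  · have := (h.hasDerivAt_curvature (e.symm s)).comp s (hd' s)
    rwa [← div_eq_mul_inv] at this
  · have := h.eventually_curvatureDot_ne_zero hnd (e.symm s)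
    rw [eventually_nhdsWithin_iff] at this ⊢
    filter_upwards [e.symm.continuous.continuousAt.eventually this] with r hr hrs
    exact hr fun h0 => hrs (e.symm.injective h0)
  · exact (e.symm.surjective.range_comp γ).symm

end IsSimpleClosed

/-- Arc length is an order isomorphism that carries `[0, L)` to `[0, P)`; the normalization `e 0 =
0` aligns the two windows in which gaps are counted. -/
theorem multiplicity_eq {γ c T : ℝ → Plane} {L P : ℝ} {e : ℝ ≃o ℝ}
    (h : Frames γ c T (curvature γ ∘ e.symm) (curvatureDot γ ∘ e.symm) P) (h0 : e 0 = 0)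
    (he : ∀ t, e (t + L) = e t + P) (E : Set Plane) :
    multiplicity γ L E =
      (gapsOver (curvature γ ∘ e.symm) (curvatureDot γ ∘ e.symm) P E).encard := by
  have hsig : ∀ t, sig (curvature γ ∘ e.symm) (curvatureDot γ ∘ e.symm) (e t) =
      paramSignature γ t := fun t => by
    simp only [sig, Function.comp, e.symm_apply_apply, paramSignature]
  have hL : e L = P := by
    have := he 0
    rwa [zero_add, h0, zero_add] at this
  have himg : ∀ a b, Ioo (e a) (e b) = e '' Ioo a b := fun a b => (e.image_Ioo a b).symm
  have hpre : passages γ L E = (e.toEquiv.prodCongr e.toEquiv) ⁻¹'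
      gapsOver (curvature γ ∘ e.symm) (curvatureDot γ ∘ e.symm) P E := by
    ext ⟨a, b⟩
    have hIco : e a ∈ Ico 0 P ↔ a ∈ Ico 0 L := by
      rw [mem_Ico, mem_Ico, ← hL, e.lt_iff_lt]
      nth_rw 1 [← h0]
      rw [e.le_iff_le]
    simp only [passages, gapsOver, IsGap, mem_ofPred_eq, mem_preimage, Equiv.prodCongr_apply,
      Prod.map_fst, Prod.map_snd, h.quiverVertices_eq, RelIso.coe_fn_toEquiv, hIco, himg,
      image_image, forall_mem_image, hsig, e.lt_iff_lt, and_assoc]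
  rw [multiplicity, hpre, encard_preimage_of_bijective (Equiv.bijective _)]

theorem isOpenSegment_comp {f : ℝ → Plane} (e : ℝ ≃o ℝ) {a b : ℝ} (hab : a < b)
    (h : Nonempty (↥((f ∘ e.symm) '' Ioo a b) ≃ₜ ↥(Ioo a b))) :
    IsOpenSegment f ((f ∘ e.symm) '' Ioo a b) := by
  obtain ⟨φ⟩ := h
  refine ⟨e.symm a, e.symm b, e.symm.strictMono hab, ?_, ⟨φ.trans ?_⟩⟩
  · rw [image_comp, e.symm.image_Ioo]
  · exact (e.symm.toHomeomorph.image (Ioo a b)).trans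
      (Homeomorph.setCongr (e.symm.image_Ioo a b))

end ArcLength

end PlaneCurve

theorem mainTheorem5 (γ : ℝ → PlaneCurve.Plane) (L : ℝ)
    (hγ : PlaneCurve.IsSimpleClosed γ L)
    (hnd : PlaneCurve.IsNondegenerate γ)
    (hfin : (PlaneCurve.quiverVertices γ).Finite)
    (hne : (PlaneCurve.quiverVertices γ).Nonempty) :
    (PlaneCurve.quiverEdges γ).Finite ∧
    (∀ E ∈ PlaneCurve.quiverEdges γ,
      PlaneCurve.IsOpenSegment (PlaneCurve.paramSignature γ) E ∧
      PlaneCurve.multiplicity γ L E ≠ ⊤ ∧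
      (PlaneCurve.components (PlaneCurve.signaturePreimage γ E)).encard
        = PlaneCurve.multiplicity γ L E ∧
      (∀ C ∈ PlaneCurve.components (PlaneCurve.signaturePreimage γ E),
        PlaneCurve.IsOpenSegment γ C ∧
        (∀ C' ∈ PlaneCurve.components (PlaneCurve.signaturePreimage γ E),
          PlaneCurve.Congruent γ C C') ∧
        (∀ p ∈ C,
          PlaneCurve.sigIndexAt γ p = PlaneCurve.multiplicity γ L E ∧
          PlaneCurve.symIndexAt γ p = PlaneCurve.multiplicity γ L E))) ∧
    IsLeast {m | ∃ E ∈ PlaneCurve.quiverEdges γ, m = PlaneCurve.multiplicity γ L E}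
      (PlaneCurve.sigIndex γ) := by
  obtain ⟨e, P, hP, h0, hd, he⟩ := hγ.exists_arcLength
  have h := hγ.frames hnd hP hd he
  rw [h.quiverVertices_eq] at hfin hne
  simp only [PlaneCurve.multiplicity_eq h h0 he]
  refine ⟨h.finite_quiverEdges hfin hne, fun E hE => ?_, h.isLeast_sigIndex hfin hne⟩
  rw [h.quiverEdges_eq hfin hne] at hE
  refine ⟨?_, encard_ne_top_iff.2 (h.finite_gapsOver hfin E), h.encard_components hfin hE, ?_⟩
  · obtain ⟨I, -, hI, rfl⟩ := hE
    exact PlaneCurve.isOpenSegment_comp (f := PlaneCurve.paramSignature γ) e hI.1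
      (h.isOpenSegment_sig hfin hI)
  · rw [h.components_signaturePreimage hfin hE]
    rintro _ ⟨I, hI, rfl⟩
    refine ⟨PlaneCurve.isOpenSegment_comp e hI.2.1.1 (h.isOpenSegment_c hI.2.1), ?_, ?_⟩
    · rintro _ ⟨I', hI', rfl⟩
      exact h.congruent_of_mem_gapsOver hfin hI hI'
    · rintro _ ⟨s, hs, rfl⟩
      rw [h.symIndexAt_eq hfin (hI.2.1.2.2.2 s hs), h.sigIndexAt_eq hfin hI.2.1 hs, hI.2.2]
      exact ⟨rfl, rfl⟩
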